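/- Let $k$ be a commutative ring with unit and let $G$ be any group. Let $B$ be the $kG$-module of all functions $f\colon G\to k$ that take only finitely many values, with $(g\cdot f)(x)=f(g^{-1}x)$; for a $kG$-module $M$, let $G$ act diagonally on $M\otimes_k B$. A $kG$-module $M$ is called cofibrant if $M\otimes_k B$ is a projective $kG$-module, and is said to have finite cofibrant dimension if $\mathrm{pd}_{kG}(M\otimes_k B)<\infty$. A $kG$-module is pure-projective if it is a direct summand of a direct sum of finitely presented $kG$-modules. Let $\mathtt{Cof}(kG)$ be the class of cofibrant $kG$-modules, $\mathcal{P}(kG)$ the class of all cokernels of acyclic ($\mathbb{Z}$-indexed) complexes of projective $kG$-modules, and $\mathtt{GProj}(kG)$ the class of Gorenstein projective $kG$-modules, i.e. of all cokernels of those acyclic complexes of projective $kG$-modules that remain acyclic after applying $\mathrm{Hom}_{kG}(-,P)$ for every projective $kG$-module $P$. The following two conditions are equivalent: (i) every pure-projective $kG$-module has finite cofibrant dimension; (ii) there is an integer $n\geq 0$ such that $\mathrm{pd}_{kG}(C\otimes_k B)\leq n$ for every finitely presented $kG$-module $C$. If they hold, then $\mathtt{Cof}(kG)=\mathtt{GProj}(kG)=\mathcal{P}(kG)$.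 -/

import Mathlib

open CategoryTheory
open scoped MonoidAlgebra TensorProduct DirectSum

universe u v w

noncomputable section

namespace GroupAlgebraModules

/-! ### Notions over an arbitrary ring -/

section Ring

variable {R : Type u} [Ring R]

/-- An acyclic (i.e. exact) complex, indexed by `ℤ`, consisting of projective modules. -/
structure IsAcyclicProjective (X : CochainComplex (ModuleCat.{w} R) ℤ) : Prop where
  projective : ∀ i : ℤ, Module.Projective R (X.X i)
  acyclic : X.Acyclic

/-- A totally acyclic complex of projective modules: it remains acyclic after applying
`Hom(_, Q)` for every projective module `Q`, that is, every cocycle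
`f ∈ ker (Hom(Xⁱ⁺¹, Q) → Hom(Xⁱ, Q))` lies in the image of `Hom(Xⁱ⁺², Q) → Hom(Xⁱ⁺¹, Q)`. -/
structure IsTotallyAcyclic (X : CochainComplex (ModuleCat.{w} R) ℤ) : Prop
    extends IsAcyclicProjective X where
  hom_exact : ∀ Q : ModuleCat.{w} R, Module.Projective R Q →
    ∀ (i : ℤ) (f : X.X (i + 1) ⟶ Q), X.d i (i + 1) ≫ f = 0 →
      ∃ g : X.X (i + 1 + 1) ⟶ Q, X.d (i + 1) (i + 1 + 1) ≫ g = f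

/-- `M` is (isomorphic to) one of the cokernels of the complex `X`. -/
def IsCokernelOf (M : ModuleCat.{w} R) (X : CochainComplex (ModuleCat.{w} R) ℤ) : Prop :=
  ∃ i : ℤ, Nonempty (M ≅ Limits.cokernel (X.d i (i + 1)))

variable (R)

/-- The class of Gorenstein projective modules: the cokernels of totally acyclic complexes of
projective modules. -/
def GProj : ObjectProperty (ModuleCat.{w} R) := fun M =>
  ∃ X : CochainComplex (ModuleCat.{w} R) ℤ, IsTotallyAcyclic X ∧ IsCokernelOf M X

/-- The class of cokernels of acyclic complexes of projective modules. -/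
def AcyclicCokernels : ObjectProperty (ModuleCat.{w} R) := fun M =>
  ∃ X : CochainComplex (ModuleCat.{w} R) ℤ, IsAcyclicProjective X ∧ IsCokernelOf M X

/-- The class of pure-projective modules: the direct summands of direct sums of finitely
presented modules. -/
def PProj : ObjectProperty (ModuleCat.{w} R) := fun M =>
  ∃ (ι : Type w) (C : ι → ModuleCat.{w} R), (∀ i, Module.FinitePresentation R (C i)) ∧
    Nonempty (Retract M (ModuleCat.of R (⨁ i, C i)))

end Ring

/-! ### Modules over a group algebra -/

section Group

variable (k : Type u) [CommRing k] (G : Type v) [Group G]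

/-- The `k`-module `B(G, k)` of all functions `G → k` that take finitely many values. -/
def B : Submodule k (G → k) where
  carrier := {f | (Set.range f).Finite}
  zero_mem' := (Set.finite_singleton (0 : k)).subset (by rintro _ ⟨_, rfl⟩; rfl)
  add_mem' := by
    intro f f' hf hf'
    refine (hf.image2 (· + ·) hf').subset ?_
    rintro _ ⟨x, rfl⟩
    exact ⟨f x, ⟨x, rfl⟩, f' x, ⟨x, rfl⟩, rfl⟩
  smul_mem' := by
    intro c f hf
    refine (hf.image (c * ·)).subset ?_
    rintro _ ⟨x, rfl⟩
    exact ⟨f x, ⟨x, rfl⟩, rfl⟩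

/-- The action of `G` on `B(G, k)` by translations, `(g • f) x = f (g⁻¹ x)`. -/
def bRep : Representation k G (B k G) where
  toFun g :=
    { toFun := fun f => ⟨fun x => f.1 (g⁻¹ * x),
        f.2.subset (by rintro _ ⟨x, rfl⟩; exact ⟨g⁻¹ * x, rfl⟩)⟩
      map_add' := fun _ _ => rfl
      map_smul' := fun _ _ => rfl }
  map_one' := by
    ext f x
    simp
  map_mul' g h := by
    ext f x
    simp [mul_assoc]

variable {k G}

/-- The `kG`-module `M ⊗_k B(G, k)` with the diagonal action `g • (x ⊗ f) = g • x ⊗ g • f`. -/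
def tensorB (M : ModuleCat.{max u v} k[G]) : ModuleCat.{max u v} k[G] :=
  ModuleCat.of k[G] ((Rep.ofModuleMonoidAlgebra.obj M).ρ.tprod (bRep k G)).asModule

variable (k G)

/-- The class of cofibrant modules: those `M` for which `M ⊗_k B(G, k)` is projective. -/
def Cof : ObjectProperty (ModuleCat.{max u v} k[G]) := fun M =>
  Module.Projective k[G] (tensorB M)

/-- The class of modules `M` of finite cofibrant dimension: those for which
`M ⊗_k B(G, k)` has finite projective dimension. -/
def FinCof : ObjectProperty (ModuleCat.{max u v} k[G]) := fun M =>
  ∃ n : ℕ, HasProjectiveDimensionLE (tensorB M) n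

end Group

end GroupAlgebraModules

end

/-!
Write `B` for the module of functions `G → k` with finitely many values. It is free over `k`
(`free_B`, from Nöbeling's theorem), so `_ ⊗ B` is exact, and it preserves projective modules,
direct sums and direct summands.

*The equivalence.* If `C n` is finitely presented with `pd (C n ⊗ B) > n` for every `n`, then the
pure-projective module `⨁ C n` has infinite cofibrant dimension; conversely, a bound for the
finitely presented modules passes to direct sums and to summands.

*Cofibrant modules are Gorenstein projective*, without further hypotheses (`cof_le_gProj`). If `M`
is cofibrant, then the constant function `1` embeds `M` in the projective module `M ⊗ B`. After
tensoring with `B` this embedding is split by the multiplication of `B`, so its cokernel is again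
cofibrant; so is the kernel of a map from a projective module onto `M`. Splicing yields an acyclic
complex of projective modules with cofibrant cokernels. It is totally acyclic, because a map to a
projective module `Q` extends along a monomorphism with cofibrant cokernel: that monomorphism
splits after tensoring with `B`, and `Q` is a retract of `Q ⊗ B`
(`exists_extension_of_cofibrant_cokernel`).

*Cokernels of acyclic complexes of projective modules are cofibrant* when `pd (C ⊗ B) ≤ n` for all
finitely presented `C` (`acyclicCokernels_le_cof`). Summing the terms of the complex reduces this
to the image of a single exact differential `d` on a projective module `P`. Then `d ⊗ B` is exact
on the projective module `P ⊗ B`; call its image `N`, so that there is an exact sequence `0 → N →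
P ⊗ B → N → 0`. Every map from a finitely presented module to `N` factors through some `C ⊗ B`
with `C` finitely presented (`exists_factorization_TB`), that is, through a module of projective
dimension at most `n`. This property with `n + 1` for a module implies the same with `n` for its
syzygies (`FactorsThroughDimLE.of_syzygy`), and `N` is its own syzygy, so that `n` can be taken to
be `0`: the module `N` is flat. It is then projective, as in the theorem of Benson and Goodearl on
flat periodic modules (`projective_range_of_factorsThroughDimLE`). The proof here shows that the
differential is contractible on finite sets (`locallyContractible_of_factorsThroughDimLE_zero`)
and that this makes it contractible (`LocallyContractible.exists_contraction`): a countable union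
of finite parts of a basis spans a contractible subcomplex, because a countable colimit of
projective modules has projective dimension at most one, and Zorn's lemma exhausts the basis by
such pieces.
-/

noncomputable section

namespace GroupAlgebraModules

/-! ### Contractions of differential modules -/

section Differential

variable {R : Type u} [Ring R]

/-- An endomorphism `d` of a module (in practice with `d ∘ d = 0`) is contractible on a set `s` if
there are `h`, `h'` with `h d + d h' = 1` on `s`; it is locally contractible if this holds for all
finite sets. The two maps may be different, and they may depend on the finite set. -/
def LocallyContractible {F : Type u} [AddCommGroup F] [Module R F] (d : F →ₗ[R] F) : Prop :=
  ∀ s : Finset F, ∃ h h' : F →ₗ[R] F, ∀ x ∈ s, h (d x) + d (h' x) = x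

/-- The colimit `N` of a sequence `G 0 → G 1 → ⋯` of projective modules has projective dimension
at most one, by the telescope sequence `0 → ⨁ G n → ⨁ G n → N → 0`. Here an element of `G n` that
vanishes in the colimit is required to vanish already in `G (n + 1)`. -/
theorem hasProjectiveDimensionLE_one_of_telescope {N : Type u} [AddCommGroup N] [Module R N]
    (G : ℕ → Type u) [∀ n, AddCommGroup (G n)] [∀ n, Module R (G n)]
    [∀ n, Module.Projective R (G n)]
    (t : ∀ n, G n →ₗ[R] G (n + 1)) (a : ∀ n, G n →ₗ[R] N)
    (hat : ∀ n x, a (n + 1) (t n x) = a n x)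
    (hker : ∀ n x, a n x = 0 → t n x = 0)
    (hsurj : ∀ y, ∃ n x, a n x = y) :
    HasProjectiveDimensionLE (ModuleCat.of R N) 1 := by
  classical
  let T : (⨁ n, G n) →ₗ[R] (⨁ n, G n) :=
    DirectSum.toModule R ℕ _ (fun n => (DirectSum.lof R ℕ G (n + 1)).comp (t n))
  let A : (⨁ n, G n) →ₗ[R] N := DirectSum.toModule R ℕ _ a
  have hT : ∀ n x, T (DirectSum.lof R ℕ G n x) = DirectSum.lof R ℕ G (n + 1) (t n x) :=
    fun n x => by simp [T]
  have hA : ∀ n x, A (DirectSum.lof R ℕ G n x) = a n x := fun n x => by simp [A]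
  have hAT : ∀ x, A (T x) = A x := by
    intro x
    have : A.comp T = A := by
      refine DirectSum.linearMap_ext R fun n => ?_
      ext x
      simp [hT, hA, hat]
    exact LinearMap.congr_fun this x
  let f : (⨁ n, G n) →ₗ[R] (⨁ n, G n) := LinearMap.id - T
  have hf : ∀ x, f x = x - T x := fun x => rfl
  -- modulo the range of `1 - T`, every element can be pushed into a single `G m`
  have hpush : ∀ x : ⨁ n, G n, ∃ m₀, ∀ m, m₀ ≤ m →
      ∃ y, x - DirectSum.lof R ℕ G m y ∈ LinearMap.range f := by
    intro x
    induction x using DirectSum.induction_on with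
    | zero => exact ⟨0, fun m _ => ⟨0, by simp⟩⟩
    | of n x =>
      refine ⟨n, fun m hm => ?_⟩
      induction m, hm using Nat.le_induction with
      | base => exact ⟨x, by simp [DirectSum.lof_eq_of]⟩
      | succ m hm ih =>
        obtain ⟨y, hy⟩ := ih
        refine ⟨t m y, ?_⟩
        have := Submodule.add_mem _ hy ⟨DirectSum.lof R ℕ G m y, hf _⟩
        rwa [hT, sub_add_sub_cancel] at this
    | add x y hx hy =>
      obtain ⟨m₁, h₁⟩ := hx
      obtain ⟨m₂, h₂⟩ := hy
      refine ⟨max m₁ m₂, fun m hm => ?_⟩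
      obtain ⟨y₁, hy₁⟩ := h₁ m (le_trans (le_max_left _ _) hm)
      obtain ⟨y₂, hy₂⟩ := h₂ m (le_trans (le_max_right _ _) hm)
      refine ⟨y₁ + y₂, ?_⟩
      rw [map_add, add_sub_add_comm]
      exact Submodule.add_mem _ hy₁ hy₂
  have hexact : Function.Exact f A := by
    intro x
    constructor
    · intro hx
      obtain ⟨m, hm⟩ := hpush x
      obtain ⟨y, z, hz⟩ := hm m le_rfl
      have h0 : a m y = 0 := by
        have : A (f z) = 0 := by rw [hf, map_sub, hAT, sub_self]
        rw [hz, map_sub, hx, hA] at this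
        simpa using this
      refine ⟨z + DirectSum.lof R ℕ G m y, ?_⟩
      rw [map_add, hz, hf, hT, hker m y h0]
      simp
    · rintro ⟨z, rfl⟩
      rw [hf, map_sub, hAT, sub_self]
  have hT0 : ∀ x, T x 0 = 0 := by
    intro x
    induction x using DirectSum.induction_on with
    | zero => simp
    | of n x =>
      rw [← DirectSum.lof_eq_of R, hT, DirectSum.lof_eq_of]
      exact DirectSum.of_eq_of_ne _ _ _ (by simp)
    | add x y hx hy => rw [map_add, DirectSum.add_apply, hx, hy, add_zero]
  have hTs : ∀ x n, T x (n + 1) = t n (x n) := by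
    intro x n
    induction x using DirectSum.induction_on with
    | zero => simp
    | of m x =>
      rw [← DirectSum.lof_eq_of R, hT, DirectSum.lof_eq_of, DirectSum.lof_eq_of]
      by_cases h : m = n
      · subst h
        rw [DirectSum.of_eq_same, DirectSum.of_eq_same]
      · rw [DirectSum.of_eq_of_ne _ _ _ (by simpa using Ne.symm h),
          DirectSum.of_eq_of_ne _ _ _ (Ne.symm h), map_zero]
    | add x y hx hy => rw [map_add, DirectSum.add_apply, hx, hy, DirectSum.add_apply, map_add]
  have hinj : Function.Injective f := by
    rw [injective_iff_map_eq_zero]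
    intro x hx
    have hx' : x = T x := sub_eq_zero.mp hx
    refine DirectSum.ext_component R fun n => ?_
    rw [map_zero]
    change x n = 0
    induction n with
    | zero => rw [hx', hT0]
    | succ n ih => rw [hx', hTs, ih, map_zero]
  have hsurjA : Function.Surjective A := by
    intro y
    obtain ⟨n, x, rfl⟩ := hsurj y
    exact ⟨_, hA n x⟩
  have hS := ModuleCat.shortComplex_shortExact
    (ShortComplex.mk (ModuleCat.ofHom f) (ModuleCat.ofHom A)
      (ModuleCat.hom_ext (LinearMap.ext fun x => (hexact (f x)).2 ⟨x, rfl⟩))) hexact hinj hsurjA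
  have hP : Projective (ModuleCat.of R (⨁ n, G n)) :=
    (IsProjective.iff_projective _).1 inferInstance
  exact (hS.hasProjectiveDimensionLT_X₃_iff 0 hP).2 inferInstance

/-- A module `N` of projective dimension at most one that sits in a short exact sequence
`0 → N → P → N → 0` with `P` projective is projective. -/
theorem projective_of_hasProjectiveDimensionLE_one {N P : Type u} [AddCommGroup N] [Module R N]
    [AddCommGroup P] [Module R P] [Module.Projective R P]
    (hN : HasProjectiveDimensionLE (ModuleCat.of R N) 1)
    (f : N →ₗ[R] P) (g : P →ₗ[R] N) (hf : Function.Injective f) (hg : Function.Surjective g)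
    (hfg : Function.Exact f g) : Module.Projective R N := by
  have hS := ModuleCat.shortComplex_shortExact
    (ShortComplex.mk (ModuleCat.ofHom f) (ModuleCat.ofHom g)
      (ModuleCat.hom_ext (LinearMap.ext fun x => (hfg (f x)).2 ⟨x, rfl⟩))) hfg hf hg
  have hP : Projective (ModuleCat.of R P) := (IsProjective.iff_projective _).1 inferInstance
  have := hS.hasProjectiveDimensionLT_X₁ 1 inferInstance hN
  exact (IsProjective.iff_projective _).2 (projective_iff_hasProjectiveDimensionLT_one.2 this)

theorem mem_supported_of_single {I : Type u} {J : Set I} {p : Submodule R (I →₀ R)}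
    (h : ∀ j ∈ J, Finsupp.single j 1 ∈ p) {x : I →₀ R} (hx : x ∈ Finsupp.supported R R J) :
    x ∈ p := by
  rw [Finsupp.supported_eq_span_single] at hx
  exact Submodule.span_le.2 (by rintro _ ⟨j, hj, rfl⟩; exact h j hj) hx

instance projective_supported {I : Type u} (J : Set I) :
    Module.Projective R (Finsupp.supported R R J) :=
  Module.Projective.of_equiv' (Finsupp.supportedEquivFinsupp J).symm

/-- Every basis element of a locally contractible differential on a free module lies in a
subcomplex, spanned by a part of the basis, that is contractible. The part is the union of finite
sets `S n`, each containing what is needed to contract the previous one. The cycles `N` of the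
subcomplex are the colimit of the stages along the maps `d h'`, which are the identity on cycles;
hence `N` has projective dimension at most one, and since the cycles are also the boundaries of a
projective module, `N` is projective and `d` splits. -/
theorem LocallyContractible.exists_contraction_on_supported {I : Type u}
    {d : (I →₀ R) →ₗ[R] (I →₀ R)} (hd : ∀ x, d (d x) = 0) (hc : LocallyContractible d) (i₀ : I) :
    ∃ J : Set I, i₀ ∈ J ∧ (∀ x ∈ Finsupp.supported R R J, d x ∈ Finsupp.supported R R J) ∧
      ∃ h : (I →₀ R) →ₗ[R] (I →₀ R), (∀ x, h x ∈ Finsupp.supported R R J) ∧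
        ∀ x ∈ Finsupp.supported R R J, h (d x) + d (h x) = x := by
  classical
  have hc' : ∀ S : Finset I, ∃ h h' : (I →₀ R) →ₗ[R] (I →₀ R),
      ∀ x ∈ Finsupp.supported R R (S : Set I), h (d x) + d (h' x) = x := by
    intro S
    obtain ⟨h, h', hh⟩ := hc (S.image fun i => Finsupp.single i 1)
    refine ⟨h, h', fun x hx => ?_⟩
    have : x ∈ LinearMap.eqLocus (h.comp d + d.comp h') LinearMap.id :=
      mem_supported_of_single (fun j hj => hh _ (Finset.mem_image_of_mem _ hj)) hx
    exact this
  choose h h' hh using hc'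
  let next : Finset I → Finset I := fun S => S ∪ S.biUnion fun j =>
    (d (Finsupp.single j 1)).support ∪ (h' S (Finsupp.single j 1)).support ∪
      (d (h' S (Finsupp.single j 1))).support
  let S : ℕ → Finset I := fun n => next^[n] {i₀}
  have hS : ∀ n, S (n + 1) = next (S n) := fun n => Function.iterate_succ_apply' _ _ _
  let F : ℕ → Submodule R (I →₀ R) := fun n => Finsupp.supported R R (S n : Set I)
  have hSsucc : ∀ n, S n ⊆ S (n + 1) := fun n => by
    rw [hS]; exact Finset.subset_union_left
  have hSmono : Monotone S := monotone_nat_of_le_succ hSsucc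
  have hmem : ∀ n (f : (I →₀ R) →ₗ[R] (I →₀ R)),
      (∀ j ∈ S n, (f (Finsupp.single j 1)).support ⊆ S (n + 1)) →
      ∀ x ∈ F n, f x ∈ F (n + 1) := by
    intro n f hf x hx
    exact mem_supported_of_single (p := (F (n + 1)).comap f)
      (fun j hj => (Finsupp.mem_supported R _).2 (by exact_mod_cast hf j hj)) hx
  have hnext : ∀ n, ∀ j ∈ S n, (d (Finsupp.single j 1)).support ∪
      (h' (S n) (Finsupp.single j 1)).support ∪
      (d (h' (S n) (Finsupp.single j 1))).support ⊆ S (n + 1) := by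
    intro n j hj
    rw [hS]
    exact (Finset.subset_biUnion_of_mem (fun j => (d (Finsupp.single j 1)).support ∪
      (h' (S n) (Finsupp.single j 1)).support ∪
      (d (h' (S n) (Finsupp.single j 1))).support) hj).trans Finset.subset_union_right
  have hF₁ : ∀ n, ∀ x ∈ F n, d x ∈ F (n + 1) := fun n => hmem n d fun j hj =>
    (Finset.subset_union_left.trans Finset.subset_union_left).trans (hnext n j hj)
  have hF₂ : ∀ n, ∀ x ∈ F n, h' (S n) x ∈ F (n + 1) := fun n => hmem n (h' (S n)) fun j hj =>
    (Finset.subset_union_right.trans Finset.subset_union_left).trans (hnext n j hj)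
  have hF₃ : ∀ n, ∀ x ∈ F n, d (h' (S n) x) ∈ F (n + 1) := fun n =>
    hmem n (d.comp (h' (S n))) fun j hj => Finset.subset_union_right.trans (hnext n j hj)
  have hfix : ∀ n, ∀ x ∈ F n, d x = 0 → d (h' (S n) x) = x := by
    intro n x hx hdx
    have := hh (S n) x hx
    rwa [hdx, map_zero, zero_add] at this
  let J : Set I := ⋃ n, (S n : Set I)
  let FJ : Submodule R (I →₀ R) := Finsupp.supported R R J
  have hFJ : ∀ n, F n ≤ FJ := fun n =>
    Finsupp.supported_mono (Set.subset_iUnion (fun n => (S n : Set I)) n)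
  have hFJ' : ∀ x ∈ FJ, ∃ n, x ∈ F n := by
    intro x hx
    have hx' : (x.support : Set I) ⊆ ⋃ n, (S n : Set I) := (Finsupp.mem_supported R x).1 hx
    obtain ⟨n, hn⟩ := Directed.exists_mem_subset_of_finset_subset_biUnion
      (fun i j => ⟨max i j, Finset.coe_subset.2 (hSmono (le_max_left i j)),
        Finset.coe_subset.2 (hSmono (le_max_right i j))⟩) hx'
    exact ⟨n, (Finsupp.mem_supported R x).2 hn⟩
  have hdJ : ∀ x ∈ FJ, d x ∈ FJ := by
    intro x hx
    obtain ⟨n, hn⟩ := hFJ' x hx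
    exact hFJ _ (hF₁ n x hn)
  let N : Submodule R (I →₀ R) := LinearMap.ker d ⊓ FJ
  have hN : HasProjectiveDimensionLE (ModuleCat.of R N) 1 := by
    refine hasProjectiveDimensionLE_one_of_telescope (fun n => F n)
      (fun n => (d.comp (h' (S n))).restrict (hF₃ n))
      (fun n => (d.comp (h' (S n))).restrict
        (q := N)
        (fun x hx => Submodule.mem_inf.2 ⟨hd _, hFJ _ (hF₃ n x hx)⟩)) ?_ ?_ ?_
    · rintro n ⟨x, hx⟩
      exact Subtype.ext (hfix (n + 1) _ (hF₃ n x hx) (hd _))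
    · rintro n ⟨x, hx⟩ h0
      exact Subtype.ext (by simpa using congrArg (fun y : N => (y : I →₀ R)) h0)
    · rintro ⟨y, hy, hyJ⟩
      obtain ⟨n, hn⟩ := hFJ' y hyJ
      exact ⟨n, ⟨y, hn⟩, Subtype.ext (hfix n y hn hy)⟩
  let δ : FJ →ₗ[R] N := d.restrict fun x hx => ⟨hd x, hdJ x hx⟩
  have hδ : Function.Surjective δ := by
    rintro ⟨y, hy, hyJ⟩
    obtain ⟨n, hn⟩ := hFJ' y hyJ
    exact ⟨⟨h' (S n) y, hFJ _ (hF₂ n y hn)⟩, Subtype.ext (hfix n y hn hy)⟩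
  have hNproj : Module.Projective R N := by
    have hproj : Module.Projective R FJ := projective_supported J
    refine projective_of_hasProjectiveDimensionLE_one (N := N) (P := FJ) hN
      (Submodule.inclusion (inf_le_right : N ≤ FJ)) δ
      (Submodule.inclusion_injective _) hδ ?_
    rintro ⟨x, hx⟩
    constructor
    · intro h0
      exact ⟨⟨x, congrArg Subtype.val h0, hx⟩, rfl⟩
    · rintro ⟨⟨y, hy, hy'⟩, hyx⟩
      obtain rfl : y = x := congrArg Subtype.val hyx
      exact Subtype.ext hy
  obtain ⟨s, hs⟩ := LinearMap.exists_rightInverse_of_surjective δ (LinearMap.range_eq_top.2 hδ)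
  have hs' : ∀ y : N, d (s y : I →₀ R) = y := fun y =>
    congrArg Subtype.val (LinearMap.congr_fun hs y)
  let e : FJ →ₗ[R] N := LinearMap.codRestrict N (FJ.subtype - FJ.subtype.comp (s.comp δ))
    (fun x => ⟨by
        change d ((x : I →₀ R) - (s (δ x) : I →₀ R)) = 0
        rw [map_sub, hs', sub_eq_zero]
        rfl, FJ.sub_mem x.2 (s (δ x)).2⟩)
  refine ⟨J, Set.mem_iUnion.2 ⟨0, by simp [S]⟩, hdJ,
    FJ.subtype.comp (s.comp (e.comp (Finsupp.restrictDom R R J))), fun x => (s _).2, ?_⟩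
  intro x hx
  have hr : ∀ y (hy : y ∈ FJ), Finsupp.restrictDom R R J y = ⟨y, hy⟩ := fun y hy =>
    LinearMap.congr_fun (Finsupp.restrictDom_comp_subtype J) ⟨y, hy⟩
  change (s (e (Finsupp.restrictDom R R J (d x))) : I →₀ R) +
    d (s (e (Finsupp.restrictDom R R J x)) : I →₀ R) = x
  rw [hs', hr x hx, hr (d x) (hdJ x hx)]
  have h1 : e ⟨d x, hdJ x hx⟩ = δ ⟨x, hx⟩ := by
    refine Subtype.ext ?_
    change d x - (s (δ ⟨d x, hdJ x hx⟩) : I →₀ R) = d x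
    have : δ ⟨d x, hdJ x hx⟩ = 0 := Subtype.ext (hd x)
    rw [this, map_zero]
    simp
  rw [h1]
  change (s (δ ⟨x, hx⟩) : I →₀ R) + (x - (s (δ ⟨x, hx⟩) : I →₀ R)) = x
  abel

/-- Local contractibility passes to retracts of differential modules. -/
theorem LocallyContractible.of_retract {F F' : Type u} [AddCommGroup F] [Module R F]
    [AddCommGroup F'] [Module R F'] {d : F →ₗ[R] F} (hc : LocallyContractible d)
    (c : F' →ₗ[R] F') (i : F' →ₗ[R] F) (p : F →ₗ[R] F') (hpi : ∀ x, p (i x) = x)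
    (hdi : ∀ x, d (i x) = i (c x)) (hpd : ∀ x, p (d x) = c (p x)) : LocallyContractible c := by
  classical
  intro s
  obtain ⟨h, h', hh⟩ := hc (s.image i)
  refine ⟨p.comp (h.comp i), p.comp (h'.comp i), fun x hx => ?_⟩
  have := congrArg p (hh (i x) (Finset.mem_image_of_mem _ hx))
  rwa [hdi, map_add, hpd, hpi] at this

/-- `h` is a contraction of the subcomplex spanned by the basis elements with index in `J`. -/
structure IsContractionOn {I : Type u} (d : (I →₀ R) →ₗ[R] (I →₀ R)) (J : Set I)
    (h : (I →₀ R) →ₗ[R] (I →₀ R)) : Prop where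
  stable : ∀ x ∈ Finsupp.supported R R J, d x ∈ Finsupp.supported R R J
  mem : ∀ x, h x ∈ Finsupp.supported R R J
  eq : ∀ x ∈ Finsupp.supported R R J, h (d x) + d (h x) = x

/-- A contraction on a proper part of the basis can be extended. If `h` is the given one, then
`q = 1 - (h d + d h)` is a chain map that identifies the quotient complex with a direct summand, so
that the quotient is locally contractible and contains a contractible piece; if `h₁` contracts that
piece, then `h + q h₁` contracts its inverse image. -/
theorem IsContractionOn.exists_extension {I : Type u} {d : (I →₀ R) →ₗ[R] (I →₀ R)}
    (hd : ∀ x, d (d x) = 0) (hc : LocallyContractible d) {J : Set I}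
    {h : (I →₀ R) →ₗ[R] (I →₀ R)} (H : IsContractionOn d J h) {i₀ : I} (hi₀ : i₀ ∉ J) :
    ∃ J' h', IsContractionOn d J' h' ∧ J ⊆ J' ∧ i₀ ∈ J' ∧
      ∀ x ∈ Finsupp.supported R R J, h' x = h x := by
  classical
  let F' := {i // i ∉ J} →₀ R
  let p : (I →₀ R) →ₗ[R] F' := Finsupp.lcomapDomain Subtype.val Subtype.val_injective
  let ι : F' →ₗ[R] (I →₀ R) := Finsupp.lmapDomain R R Subtype.val
  let q : (I →₀ R) →ₗ[R] (I →₀ R) := LinearMap.id - (h.comp d + d.comp h)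
  have hq : ∀ x, q x = x - (h (d x) + d (h x)) := fun x => rfl
  have hp : ∀ x (i : {i // i ∉ J}), p x i = x i := fun x i => rfl
  have hp0 : ∀ x, p x = 0 ↔ x ∈ Finsupp.supported R R J := by
    intro x
    rw [Finsupp.mem_supported']
    exact ⟨fun h0 i hi => DFunLike.congr_fun h0 ⟨i, hi⟩, fun h0 => Finsupp.ext fun i => h0 i i.2⟩
  have hpι : ∀ y, p (ι y) = y := fun y =>
    Finsupp.ext fun i => Finsupp.mapDomain_apply Subtype.val_injective y i
  have hq0 : ∀ x ∈ Finsupp.supported R R J, q x = 0 := fun x hx => by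
    rw [hq, H.eq x hx, sub_self]
  have hpq : ∀ x, p (q x) = p x := by
    intro x
    rw [hq, map_sub, (hp0 _).2 (Submodule.add_mem _ (H.mem _) (H.stable _ (H.mem _))), sub_zero]
  have hdq : ∀ x, d (q x) = q (d x) := by
    intro x
    simp only [hq, map_sub, map_add, hd, map_zero, zero_add, add_zero]
  let i : F' →ₗ[R] (I →₀ R) := q.comp ι
  have hi : ∀ y, i y = q (ι y) := fun y => rfl
  have hpi : ∀ y, p (i y) = y := fun y => by rw [hi, hpq, hpι]
  have hip : ∀ x, i (p x) = q x := by
    intro x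
    rw [hi, ← sub_eq_zero, ← map_sub]
    exact hq0 _ ((hp0 _).1 (by rw [map_sub, hpι, sub_self]))
  let c : F' →ₗ[R] F' := p.comp (d.comp i)
  have hdi : ∀ y, d (i y) = i (c y) := by
    intro y
    change d (q (ι y)) = i (p (d (q (ι y))))
    have hqq : ∀ x, q (q x) = q x := fun x => by
      rw [← sub_eq_zero, ← map_sub]
      exact hq0 _ ((hp0 _).1 (by rw [map_sub, hpq, sub_self]))
    rw [hip, hdq, hqq]
  have hpd : ∀ x, p (d x) = c (p x) := by
    intro x
    change _ = p (d (i (p x)))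
    rw [hip, hdq, hpq]
  have hcc : ∀ y, c (c y) = 0 := by
    intro y
    rw [← hpi (c (c y)), ← hdi, ← hdi, hd, map_zero]
  obtain ⟨J₁, hJ₁, hcJ, h₁, hh₁, heq⟩ :=
    (hc.of_retract c i p hpi hdi hpd).exists_contraction_on_supported hcc ⟨i₀, hi₀⟩
  have hmem : ∀ x, x ∈ Finsupp.supported R R (J ∪ Subtype.val '' J₁) ↔
      p x ∈ Finsupp.supported R R J₁ := by
    intro x
    rw [Finsupp.mem_supported', Finsupp.mem_supported']
    constructor
    · rintro h0 ⟨j, hj⟩ hj'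
      refine h0 j ?_
      rintro (h' | ⟨j', h', rfl⟩)
      · exact hj h'
      · exact hj' h'
    · intro h0 j hj
      exact h0 ⟨j, fun h' => hj (Or.inl h')⟩ fun h' => hj (Or.inr ⟨_, h', rfl⟩)
  refine ⟨J ∪ Subtype.val '' J₁, h + i.comp (h₁.comp p), ⟨?_, ?_, ?_⟩, Set.subset_union_left,
    Or.inr ⟨_, hJ₁, rfl⟩, ?_⟩
  · intro x hx
    rw [hmem] at hx ⊢
    rw [hpd]
    exact hcJ _ hx
  · intro x
    refine Submodule.add_mem _ (Finsupp.supported_mono Set.subset_union_left (H.mem x)) ?_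
    rw [hmem]
    change p (i (h₁ (p x))) ∈ _
    rw [hpi]
    exact hh₁ _
  · intro x hx
    rw [hmem] at hx
    have h1 : i (h₁ (c (p x))) + d (i (h₁ (p x))) = q x := by
      rw [hdi, ← map_add, heq _ hx, hip]
    change h (d x) + i (h₁ (p (d x))) + d (h x + i (h₁ (p x))) = x
    rw [map_add, hpd, add_add_add_comm, h1, hq]
    abel
  · intro x hx
    change h x + i (h₁ (p x)) = h x
    rw [(hp0 x).2 hx, map_zero, map_zero, add_zero]

/-- A locally contractible differential on a free module is contractible, by Zorn's lemma for the
contractions on parts of the basis, ordered by extension. -/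
theorem LocallyContractible.exists_contraction_of_free {I : Type u}
    {d : (I →₀ R) →ₗ[R] (I →₀ R)} (hd : ∀ x, d (d x) = 0) (hc : LocallyContractible d) :
    ∃ h : (I →₀ R) →ₗ[R] (I →₀ R), ∀ x, h (d x) + d (h x) = x := by
  classical
  let α := {a : Set I × ((I →₀ R) →ₗ[R] (I →₀ R)) // IsContractionOn d a.1 a.2}
  let r : α → α → Prop := fun a b =>
    a.1.1 ⊆ b.1.1 ∧ ∀ x ∈ Finsupp.supported R R a.1.1, b.1.2 x = a.1.2 x
  have hsingle : ∀ {J : Set I} {i}, i ∈ J → (Finsupp.single i 1 : I →₀ R) ∈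
      Finsupp.supported R R J := fun hi => Finsupp.single_mem_supported R 1 hi
  obtain ⟨⟨⟨J, h⟩, H⟩, hmax⟩ : ∃ m : α, ∀ a, r m a → r a m := by
    refine exists_maximal_of_chains_bounded (fun C hC => ?_) (fun {a b c} hab hbc =>
      ⟨hab.1.trans hbc.1, fun x hx =>
        (hbc.2 x (Finsupp.supported_mono hab.1 hx)).trans (hab.2 x hx)⟩)
    let J : Set I := ⋃ a ∈ C, a.1.1
    let g : I → (I →₀ R) := fun i =>
      if hi : ∃ a ∈ C, i ∈ a.1.1 then hi.choose.1.2 (Finsupp.single i 1) else 0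
    have hg : ∀ a ∈ C, ∀ i ∈ a.1.1, g i = a.1.2 (Finsupp.single i 1) := by
      intro a ha i hi
      have hi' : ∃ a ∈ C, i ∈ a.1.1 := ⟨a, ha, hi⟩
      simp only [g, dif_pos hi']
      obtain ⟨hb, hib⟩ := hi'.choose_spec
      rcases eq_or_ne a hi'.choose with hab | hab
      · rw [← hab]
      · rcases hC ha hb hab with h' | h'
        · exact h'.2 _ (hsingle hi)
        · exact (h'.2 _ (hsingle hib)).symm
    let h : (I →₀ R) →ₗ[R] (I →₀ R) := Finsupp.linearCombination R g
    have hh : ∀ a ∈ C, ∀ x ∈ Finsupp.supported R R a.1.1, h x = a.1.2 x := by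
      intro a ha x hx
      have : x ∈ LinearMap.eqLocus h a.1.2 :=
        mem_supported_of_single (fun j hj => by simp [h, hg a ha j hj]) hx
      exact this
    have hJ : ∀ a ∈ C, a.1.1 ⊆ J := fun a ha => Set.subset_biUnion_of_mem (u := fun a => a.1.1) ha
    have hJ' : ∀ p : Submodule R (I →₀ R),
        (∀ a ∈ C, ∀ x ∈ Finsupp.supported R R a.1.1, x ∈ p) →
        ∀ x ∈ Finsupp.supported R R J, x ∈ p := by
      intro p hp x hx
      refine mem_supported_of_single (fun j hj => ?_) hx
      obtain ⟨a, ha, hja⟩ := Set.mem_iUnion₂.1 hj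
      exact hp a ha _ (hsingle hja)
    refine ⟨⟨(J, h), ?_, ?_, ?_⟩, fun a ha => ⟨hJ a ha, hh a ha⟩⟩
    · exact hJ' ((Finsupp.supported R R J).comap d) fun a ha x hx =>
        Finsupp.supported_mono (hJ a ha) (a.2.stable x hx)
    · intro x
      change Finsupp.linearCombination R g x ∈ _
      rw [Finsupp.linearCombination_apply]
      refine Submodule.finsuppSum_mem _ _ _ _ fun i _ => Submodule.smul_mem _ _ ?_
      by_cases hi : ∃ a ∈ C, i ∈ a.1.1
      · obtain ⟨a, ha, hia⟩ := hi
        rw [hg a ha i hia]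
        exact Finsupp.supported_mono (hJ a ha) (a.2.mem _)
      · simp only [g, dif_neg hi]
        exact Submodule.zero_mem _
    · exact hJ' (LinearMap.eqLocus (h.comp d + d.comp h) LinearMap.id) fun a ha x hx => by
        change h (d x) + d (h x) = x
        rw [hh a ha x hx, hh a ha _ (a.2.stable x hx)]
        exact a.2.eq x hx
  have hJ : J = Set.univ := by
    by_contra hne
    obtain ⟨i₀, hi₀⟩ := (Set.ne_univ_iff_exists_notMem J).1 hne
    obtain ⟨J', h', H', hJJ', hi₀', hext⟩ := H.exists_extension hd hc hi₀
    exact hi₀ ((hmax ⟨(J', h'), H'⟩ ⟨hJJ', hext⟩).1 hi₀')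
  exact ⟨h, fun x => H.eq x (by rw [hJ, Finsupp.supported_univ]; trivial)⟩

/-- Eilenberg swindle: the sum of a projective module `P` and a suitable free module is free. If
`P × E` is free, then so is the sum of countably many copies of it, and this sum absorbs `P`. -/
theorem exists_prod_equiv_free (P : Type u) [AddCommGroup P] [Module R P]
    [Module.Projective R P] : ∃ I : Type u, Nonempty ((P × (I →₀ R)) ≃ₗ[R] (I →₀ R)) := by
  classical
  obtain ⟨s, hs⟩ := Module.Projective.out (R := R) (P := P)
  let f : (P →₀ R) →ₗ[R] P := Finsupp.linearCombination R id
  let E := LinearMap.ker f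
  have hfs : ∀ x, f (s x) = x := hs
  let e : (P × E) ≃ₗ[R] (P →₀ R) := LinearEquiv.ofBijective (s.coprod E.subtype) <| by
    constructor
    · rw [injective_iff_map_eq_zero]
      rintro ⟨p, x, hx⟩ h0
      have h1 : s p + x = 0 := h0
      have hp : p = 0 := by
        have := congrArg f h1
        rwa [map_add, hfs, LinearMap.mem_ker.1 hx, add_zero, map_zero] at this
      rw [hp, map_zero, zero_add] at h1
      exact Prod.ext hp (Subtype.ext h1)
    · intro x
      refine ⟨(f x, ⟨x - s (f x), ?_⟩), ?_⟩
      · rw [LinearMap.mem_ker, map_sub, hfs, sub_self]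
      · change s (f x) + (x - s (f x)) = x
        abel
  let a : (P × E) →ₗ[R] (P × E) := (LinearMap.inl R P E).comp (LinearMap.fst R P E)
  let b : (P × E) →ₗ[R] (P × E) := (LinearMap.inr R P E).comp (LinearMap.snd R P E)
  -- the copies of `P` are shifted by one place, the copies of `E` are not
  let shift : (ℕ →₀ (P × E)) →ₗ[R] P × (ℕ →₀ (P × E)) := LinearMap.prod
    ((LinearMap.fst R P E).comp (Finsupp.lapply 0))
    ((Finsupp.mapRange.linearMap a).comp (Finsupp.lcomapDomain Nat.succ Nat.succ_injective) +
      Finsupp.mapRange.linearMap b)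
  have hshift : ∀ x, shift x = ((x 0).1, (shift x).2) := fun x => rfl
  have hshift' : ∀ x n, (shift x).2 n = ((x (n + 1)).1, (x n).2) := by
    intro x n
    change a (x (n + 1)) + b (x n) = _
    simp [a, b]
  let e₁ : (ℕ →₀ (P × E)) ≃ₗ[R] P × (ℕ →₀ (P × E)) := LinearEquiv.ofBijective shift <| by
    constructor
    · intro x y hxy
      refine Finsupp.ext fun n => Prod.ext ?_ ?_
      · cases n with
        | zero => exact (congrArg Prod.fst hxy :)
        | succ n =>
          have := congrArg (fun z => (z.2 n).1) hxy
          simpa only [hshift'] using this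
      · have := congrArg (fun z => (z.2 n).2) hxy
        simpa only [hshift'] using this
    · rintro ⟨p, y⟩
      refine ⟨Finsupp.single 0 (p, 0) + Finsupp.mapDomain Nat.succ
        (Finsupp.mapRange.linearMap a y) + Finsupp.mapRange.linearMap b y, ?_⟩
      have h0 : Finsupp.mapDomain Nat.succ (Finsupp.mapRange.linearMap a y) 0 = 0 :=
        Finsupp.mapDomain_of_notMem_range _ _ (by simp)
      have h1 : ∀ n, (Finsupp.mapDomain Nat.succ (Finsupp.mapRange.linearMap a y) n).2 = 0 := by
        intro n
        cases n with
        | zero => rw [h0]; rfl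
        | succ n => rw [← Nat.succ_eq_add_one, Finsupp.mapDomain_apply Nat.succ_injective]; rfl
      refine Prod.ext ?_ (Finsupp.ext fun n => ?_)
      · rw [hshift, Finsupp.add_apply, Finsupp.add_apply, h0, Finsupp.single_eq_same]
        simp [b]
      · rw [hshift', ← Nat.succ_eq_add_one]
        simp only [Finsupp.add_apply, Prod.fst_add, Prod.snd_add, h1,
          Finsupp.mapDomain_apply Nat.succ_injective]
        rcases n with _ | n <;> simp [a, b]
  let e₂ : (ℕ →₀ (P × E)) ≃ₗ[R] ((ℕ × P) →₀ R) :=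
    (Finsupp.mapRange.linearEquiv e).trans (Finsupp.curryLinearEquiv R).symm
  exact ⟨ℕ × P, ⟨((LinearEquiv.refl R P).prodCongr e₂.symm).trans (e₁.symm.trans e₂)⟩⟩

/-- A locally contractible differential on a projective module is contractible. -/
theorem LocallyContractible.exists_contraction {F : Type u} [AddCommGroup F] [Module R F]
    [Module.Projective R F] {d : F →ₗ[R] F} (hd : ∀ x, d (d x) = 0)
    (hc : LocallyContractible d) : ∃ h : F →ₗ[R] F, ∀ x, h (d x) + d (h x) = x := by
  classical
  obtain ⟨I, ⟨e⟩⟩ := exists_prod_equiv_free (R := R) F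
  -- add the contractible complex `(y, z) ↦ (z, 0)` to make the module free
  let L := I →₀ R
  let e' : (F × L × L) ≃ₗ[R] ((I ⊕ I) →₀ R) :=
    (LinearEquiv.prodAssoc R F L L).symm.trans
      ((e.prodCongr (LinearEquiv.refl R L)).trans (Finsupp.sumFinsuppLEquivProdFinsupp R).symm)
  let D : (F × L × L) →ₗ[R] (F × L × L) :=
    d.prodMap (LinearMap.prod (LinearMap.snd R L L) 0)
  have hD : ∀ x, D x = (d x.1, x.2.2, 0) := fun x => rfl
  have hDD : ∀ x, D (D x) = 0 := fun x => by simp [hD, hd]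
  have hcD : LocallyContractible D := by
    intro S
    obtain ⟨h, h', hh⟩ := hc (S.image Prod.fst)
    refine ⟨h.prodMap (LinearMap.prod 0 (LinearMap.fst R L L)),
      h'.prodMap (LinearMap.prod 0 (LinearMap.fst R L L)), fun x hx => ?_⟩
    have := hh x.1 (Finset.mem_image_of_mem _ hx)
    refine Prod.ext this (Prod.ext ?_ ?_) <;> simp [hD]
  let c := e'.toLinearMap.comp (D.comp e'.symm.toLinearMap)
  have hce : ∀ x, c x = e' (D (e'.symm x)) := fun x => rfl
  have hcc : ∀ x, c (c x) = 0 := fun x => by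
    rw [hce, hce, e'.symm_apply_apply, hDD, map_zero]
  obtain ⟨h, hh⟩ := (hcD.of_retract c e'.symm.toLinearMap e'.toLinearMap
    (fun x => e'.apply_symm_apply x)
    (fun x => by simp [hce]) (fun x => by simp [hce])).exists_contraction_of_free hcc
  refine ⟨(LinearMap.fst R F (L × L)).comp (e'.symm.toLinearMap.comp
    (h.comp (e'.toLinearMap.comp (LinearMap.inl R F (L × L))))), fun x => ?_⟩
  have := congrArg (fun y => (e'.symm y).1) (hh (e' (x, 0)))
  simp only [hce, map_add, e'.symm_apply_apply, Prod.fst_add] at this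
  exact this

end Differential

/-! ### Maps from finitely presented modules -/

section FlatDimension

variable {R : Type u} [Ring R]

variable (R) in
/-- Every map from a finitely presented module to `N` factors through a module of projective
dimension at most `n`. For `n = 0` this is one of the characterizations of flatness; in general it
serves as a substitute for "`N` has flat dimension at most `n`". -/
def FactorsThroughDimLE (N : Type u) [AddCommGroup N] [Module R N] (n : ℕ) : Prop :=
  ∀ (D : Type u) [AddCommGroup D] [Module R D] [Module.FinitePresentation R D] (f : D →ₗ[R] N),
    ∃ L : ModuleCat.{u} R, HasProjectiveDimensionLE L n ∧
      ∃ (g : D →ₗ[R] L) (h : L →ₗ[R] N), h.comp g = f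

/-- On a finite subset of a projective module, the identity factors through a finite free module. -/
theorem exists_factorization_on_finset {P : Type u} [AddCommGroup P] [Module R P]
    [Module.Projective R P] (S : Finset P) :
    ∃ (J : Finset P) (a : (J →₀ R) →ₗ[R] P) (b : P →ₗ[R] (J →₀ R)), ∀ x ∈ S, a (b x) = x := by
  classical
  obtain ⟨s, hs⟩ := Module.Projective.out (R := R) (P := P)
  refine ⟨S.biUnion fun x => (s x).support,
    (Finsupp.linearCombination R id).comp (Finsupp.lmapDomain R R Subtype.val),
    (Finsupp.lcomapDomain Subtype.val Subtype.val_injective).comp s, fun x hx => ?_⟩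
  conv_rhs => rw [← hs x]
  change Finsupp.linearCombination R id (Finsupp.mapDomain Subtype.val
    (Finsupp.comapDomain Subtype.val (s x) _)) = _
  rw [Finsupp.mapDomain_comapDomain _ Subtype.val_injective]
  intro i hi
  exact ⟨⟨i, Finset.mem_biUnion.2 ⟨x, hx, hi⟩⟩, rfl⟩

/-- Passing from `N` to its syzygy `N'` lowers the dimension by one. A map `φ` from a finitely
presented module `D` to `N'` comes from a map `δ` to a finite free module `G` over `Q`, and so
induces a map from `G / δ(D)` to `N`. If this factors through `L`, then `φ` factors through the kernel of a
map from a free module onto `L`. -/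
theorem FactorsThroughDimLE.of_syzygy {N' Q N : Type u} [AddCommGroup N'] [Module R N']
    [AddCommGroup Q] [Module R Q] [AddCommGroup N] [Module R N] [Module.Projective R Q] {n : ℕ}
    (H : FactorsThroughDimLE R N (n + 1)) (f : N' →ₗ[R] Q) (g : Q →ₗ[R] N)
    (hf : Function.Injective f) (hg : Function.Surjective g) (hfg : Function.Exact f g) :
    FactorsThroughDimLE R N' n := by
  classical
  intro D _ _ _ φ
  obtain ⟨S, hS⟩ := Module.Finite.fg_top (R := R) (M := D)
  obtain ⟨J, a, b, hab⟩ := exists_factorization_on_finset (R := R) (S.image fun x => f (φ x))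
  let G := J →₀ R
  let δ : D →ₗ[R] G := b.comp (f.comp φ)
  have hδ : ∀ x, a (δ x) = f (φ x) := by
    intro x
    have hx : x ∈ Submodule.span R (S : Set D) := hS ▸ Submodule.mem_top
    have : x ∈ LinearMap.eqLocus (a.comp δ) (f.comp φ) :=
      Submodule.span_le.2 (fun y hy => hab _ (Finset.mem_image_of_mem _ hy)) hx
    exact this
  let E := G ⧸ LinearMap.range δ
  have hE : Module.FinitePresentation R E := by
    refine Module.finitePresentation_of_surjective (LinearMap.range δ).mkQ
      (Submodule.mkQ_surjective _) ?_
    rw [Submodule.ker_mkQ, LinearMap.range_eq_map]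
    exact Module.Finite.fg_top.map δ
  let ε : E →ₗ[R] N := (LinearMap.range δ).liftQ (g.comp a) <| by
    rintro _ ⟨x, rfl⟩
    change g (a (δ x)) = 0
    rw [hδ]
    exact (hfg _).2 ⟨_, rfl⟩
  obtain ⟨L, hL, e, l, hle⟩ := H E ε
  have hle' : ∀ x, l (e (Submodule.Quotient.mk x)) = g (a x) := fun x =>
    LinearMap.congr_fun hle (Submodule.Quotient.mk x)
  let s : (L →₀ R) →ₗ[R] L := Finsupp.linearCombination R id
  have hs : Function.Surjective s := Finsupp.linearCombination_id_surjective R L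
  obtain ⟨t, ht⟩ := Module.projective_lifting_property g (l.comp s) hg
  have ht' : ∀ q, g (t q) = l (s q) := fun q => LinearMap.congr_fun ht q
  -- adding `G` to the projective cover of `L` makes the two copies of `G` match on the nose
  let σ : ((L →₀ R) × G) →ₗ[R] L := s.coprod (e.comp (LinearMap.range δ).mkQ)
  have hσ : ∀ x, σ x = s x.1 + e (Submodule.Quotient.mk x.2) := fun x => rfl
  have hσs : Function.Surjective σ := fun y => by
    obtain ⟨x, rfl⟩ := hs y
    exact ⟨(x, 0), by rw [hσ]; simp⟩
  have hK : HasProjectiveDimensionLE (ModuleCat.of R (LinearMap.ker σ)) n := by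
    have : Projective (ModuleCat.of R ((L →₀ R) × G)) :=
      (IsProjective.iff_projective _).1 inferInstance
    exact (LinearMap.shortExact_shortComplexKer hσs).hasProjectiveDimensionLT_X₁ (n + 1)
      (hasProjectiveDimensionLT_of_ge _ 1 _ (by omega)) hL
  have hκ : ∀ x : LinearMap.ker σ, (t.coprod a) (x : (L →₀ R) × G) ∈ LinearMap.range f := by
    rintro ⟨x, hx⟩
    rw [← hfg.linearMap_ker_eq, LinearMap.mem_ker]
    change g (t x.1 + a x.2) = 0
    rw [map_add, ht', ← hle', ← map_add, ← hσ, LinearMap.mem_ker.1 hx, map_zero]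
  let κ : LinearMap.ker σ →ₗ[R] N' := (LinearEquiv.ofInjective f hf).symm.toLinearMap.comp
    (((t.coprod a).comp (LinearMap.ker σ).subtype).codRestrict _ hκ)
  refine ⟨_, hK, ((LinearMap.inr R (L →₀ R) G).comp δ).codRestrict _ fun x => ?_, κ, ?_⟩
  · change s 0 + e (Submodule.Quotient.mk (δ x)) = 0
    rw [(Submodule.Quotient.mk_eq_zero _).2 (LinearMap.mem_range_self δ x),
      map_zero, map_zero, add_zero]
  · ext x
    apply hf
    change f ((LinearEquiv.ofInjective f hf).symm _) = _
    rw [LinearEquiv.ofInjective_symm_apply]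
    change t 0 + a (δ x) = _
    rw [map_zero, zero_add, hδ]

/-- An exact differential on a projective module whose image has property
`FactorsThroughDimLE _ _ 0`, that is, is flat, is locally contractible. -/
theorem locallyContractible_of_factorsThroughDimLE_zero {F : Type u} [AddCommGroup F] [Module R F]
    [Module.Projective R F] {d : F →ₗ[R] F} (hd : Function.Exact d d)
    (H : FactorsThroughDimLE R (LinearMap.range d) 0) : LocallyContractible d := by
  classical
  have hdd : ∀ x, d (d x) = 0 := fun x => (hd _).2 ⟨x, rfl⟩
  -- maps from projectives to the kernel of `d` lift along `d`
  have lift : ∀ {P : Type u} [AddCommGroup P] [Module R P] [Module.Projective R P]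
      (f : P →ₗ[R] F), (∀ x, d (f x) = 0) → ∃ g : P →ₗ[R] F, ∀ x, d (g x) = f x := by
    intro P _ _ _ f hf
    obtain ⟨g, hg⟩ := Module.projective_lifting_property d.rangeRestrict
      (f.codRestrict (LinearMap.range d) fun x => (hd _).1 (hf x)) d.surjective_rangeRestrict
    exact ⟨g, fun x => congrArg Subtype.val (LinearMap.congr_fun hg x)⟩
  -- `a` sends the span `T` of the `b (d x)` to cycles; flatness of the image allows a correction of
  -- `a` by a map that vanishes on `T`, after which all its values are cycles
  have step : ∀ S : Finset F, ∃ h : F →ₗ[R] F, ∀ x ∈ S, d (h (d x)) = d x := by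
    intro S
    obtain ⟨J, a, b, hab⟩ := exists_factorization_on_finset (R := R) (S.image d)
    let T : Submodule R (J →₀ R) := Submodule.span R (S.image fun x => b (d x) : Finset (J →₀ R))
    have hfp : Module.FinitePresentation R ((J →₀ R) ⧸ T) :=
      Module.finitePresentation_of_surjective T.mkQ (Submodule.mkQ_surjective _)
        (by rw [Submodule.ker_mkQ]; exact ⟨_, rfl⟩)
    have hab' : ∀ x ∈ S, a (b (d x)) = d x := fun x hx => hab _ (Finset.mem_image_of_mem _ hx)
    obtain ⟨L, hL, e, l, hle⟩ := H _ (T.liftQ (d.rangeRestrict.comp a) <| by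
      refine Submodule.span_le.2 fun y hy => ?_
      obtain ⟨x, hx, rfl⟩ := Finset.mem_image.1 (Finset.mem_coe.1 hy)
      refine Subtype.ext ?_
      change d (a (b (d x))) = 0
      rw [hab' x hx, hdd])
    have hLp : Module.Projective R L :=
      (IsProjective.iff_projective L).2 ((projective_iff_hasProjectiveDimensionLE_zero _).2 hL)
    obtain ⟨ℓ, hℓ⟩ :=
      Module.projective_lifting_property d.rangeRestrict l d.surjective_rangeRestrict
    have hℓ' : ∀ x, d (ℓ (e (T.mkQ x))) = d (a x) := fun x => by
      have h1 := congrArg Subtype.val (LinearMap.congr_fun hℓ (e (T.mkQ x)))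
      have h2 := congrArg Subtype.val (LinearMap.congr_fun hle (T.mkQ x))
      exact h1.trans h2
    obtain ⟨h, hh⟩ := lift (a - ℓ.comp (e.comp T.mkQ)) fun x => by
      change d (a x - ℓ (e (T.mkQ x))) = 0
      rw [map_sub, hℓ', sub_self]
    refine ⟨h.comp b, fun x hx => ?_⟩
    change d (h (b (d x))) = _
    rw [hh]
    change a (b (d x)) - ℓ (e (T.mkQ (b (d x)))) = d x
    have : T.mkQ (b (d x)) = 0 := by
      rw [Submodule.mkQ_apply, Submodule.Quotient.mk_eq_zero]
      exact Submodule.subset_span (Finset.mem_coe.2 (Finset.mem_image_of_mem _ hx))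
    rw [this, map_zero, map_zero, sub_zero, hab' x hx]
  intro S
  obtain ⟨J, a, b, hab⟩ := exists_factorization_on_finset (R := R) S
  obtain ⟨h, hh⟩ := step (Finset.univ.image fun j : J => a (Finsupp.single j 1))
  have hda : ∀ x, d (h (d (a x))) = d (a x) := by
    intro x
    have : (d.comp (h.comp (d.comp a))) = d.comp a := by
      refine Finsupp.lhom_ext' fun j => LinearMap.ext_ring ?_
      exact hh _ (Finset.mem_image_of_mem _ (Finset.mem_univ j))
    exact LinearMap.congr_fun this x
  obtain ⟨h', hh'⟩ := lift (a - h.comp (d.comp a)) fun x => by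
    change d (a x - h (d (a x))) = 0
    rw [map_sub, hda, sub_self]
  refine ⟨h, h'.comp b, fun x hx => ?_⟩
  change h (d x) + d (h' (b x)) = x
  rw [hh']
  change h (d x) + (a (b x) - h (d (a (b x)))) = x
  rw [hab x hx]
  abel

/-- Let `0 → N → F → N → 0` be exact with `F` projective. If, for some `n`, all maps from finitely
presented modules to `N` factor through modules of projective dimension at most `n`, then `N` is
projective. Passing to syzygies, that is, from `N` to `N`, lowers `n` to zero, so that `N` is flat;
and flat modules with this periodicity are projective. -/
theorem projective_range_of_factorsThroughDimLE {F : Type u} [AddCommGroup F] [Module R F]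
    [Module.Projective R F] {d : F →ₗ[R] F} (hd : Function.Exact d d) {n : ℕ}
    (H : FactorsThroughDimLE R (LinearMap.range d) n) :
    Module.Projective R (LinearMap.range d) := by
  have hdd : ∀ x, d (d x) = 0 := fun x => (hd _).2 ⟨x, rfl⟩
  have H₀ : FactorsThroughDimLE R (LinearMap.range d) 0 := by
    induction n with
    | zero => exact H
    | succ n ih =>
      refine ih (H.of_syzygy (LinearMap.range d).subtype d.rangeRestrict Subtype.val_injective
        d.surjective_rangeRestrict fun x => ?_)
      rw [Submodule.coe_subtype, Subtype.range_coe]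
      exact Subtype.ext_iff.trans (hd x)
  obtain ⟨h, hh⟩ :=
    (locallyContractible_of_factorsThroughDimLE_zero hd H₀).exists_contraction hdd
  refine Module.Projective.of_split (LinearMap.range d).subtype (d.rangeRestrict.comp h) ?_
  ext ⟨_, x, rfl⟩
  have := hh (d x)
  rw [hdd, map_zero, zero_add] at this
  exact this

/-! ### Projective dimension of direct sums -/

theorem exact_lmap {ι : Type u} {K M N : ι → Type u} [∀ i, AddCommGroup (K i)]
    [∀ i, Module R (K i)] [∀ i, AddCommGroup (M i)] [∀ i, Module R (M i)]
    [∀ i, AddCommGroup (N i)] [∀ i, Module R (N i)] {f : ∀ i, K i →ₗ[R] M i}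
    {g : ∀ i, M i →ₗ[R] N i} (H : ∀ i, Function.Exact (f i) (g i)) :
    Function.Exact (DirectSum.lmap f) (DirectSum.lmap g) := by
  classical
  intro y
  constructor
  · intro hy
    have hy' : ∀ i, g i (y i) = 0 := fun i => by rw [← DirectSum.lmap_apply, hy]; rfl
    change y ∈ LinearMap.range (DirectSum.lmap f)
    rw [← DirectSum.sum_support_of y]
    refine Submodule.sum_mem _ fun i _ => ?_
    obtain ⟨x, hx⟩ := (H i _).1 (hy' i)
    exact ⟨DirectSum.lof R ι K i x, by rw [DirectSum.lmap_lof, hx]; rfl⟩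
  · rintro ⟨x, rfl⟩
    refine DirectSum.ext_component R fun i => ?_
    exact (H i _).2 ⟨x i, rfl⟩

theorem hasProjectiveDimensionLE_succ_directSum {ι : Type u} {K M N : ι → Type u}
    [∀ i, AddCommGroup (K i)] [∀ i, Module R (K i)] [∀ i, AddCommGroup (M i)]
    [∀ i, Module R (M i)] [∀ i, AddCommGroup (N i)] [∀ i, Module R (N i)]
    [∀ i, Module.Projective R (M i)] {f : ∀ i, K i →ₗ[R] M i} {g : ∀ i, M i →ₗ[R] N i}
    (hf : ∀ i, Function.Injective (f i)) (hg : ∀ i, Function.Surjective (g i))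
    (H : ∀ i, Function.Exact (f i) (g i)) {n : ℕ}
    (hK : HasProjectiveDimensionLE (ModuleCat.of R (⨁ i, K i)) n) :
    HasProjectiveDimensionLE (ModuleCat.of R (⨁ i, N i)) (n + 1) := by
  classical
  have hfg := exact_lmap H
  have hS := ModuleCat.shortComplex_shortExact
    (ShortComplex.mk
      (ModuleCat.ofHom (X := ⨁ i, K i) (Y := ⨁ i, M i) (DirectSum.lmap f))
      (ModuleCat.ofHom (X := ⨁ i, M i) (Y := ⨁ i, N i) (DirectSum.lmap g))
      (ModuleCat.hom_ext (LinearMap.ext fun x => (hfg _).2 ⟨x, rfl⟩)))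
    hfg ((DirectSum.lmap_injective f).2 hf) ((DirectSum.lmap_surjective g).2 hg)
  have hP : Projective (ModuleCat.of R (⨁ i, M i)) :=
    (IsProjective.iff_projective _).1 inferInstance
  exact (hS.hasProjectiveDimensionLT_X₃_iff n hP).2 hK

theorem hasProjectiveDimensionLE_directSum {ι : Type u} (M : ι → ModuleCat.{u} R) (n : ℕ)
    (hM : ∀ i, HasProjectiveDimensionLE (M i) n) :
    HasProjectiveDimensionLE (ModuleCat.of R (⨁ i, M i)) n := by
  classical
  induction n generalizing M with
  | zero =>
    have : ∀ i, Module.Projective R (M i) := fun i =>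
      (IsProjective.iff_projective (M i)).2
        ((projective_iff_hasProjectiveDimensionLE_zero _).2 (hM i))
    exact (projective_iff_hasProjectiveDimensionLE_zero _).1
      ((IsProjective.iff_projective _).1 inferInstance)
  | succ n ih =>
    let s : ∀ i, (M i →₀ R) →ₗ[R] M i := fun i => Finsupp.linearCombination R id
    have hs : ∀ i, Function.Surjective (s i) := fun i =>
      Finsupp.linearCombination_id_surjective R (M i)
    have hK : ∀ i, HasProjectiveDimensionLE (ModuleCat.of R (LinearMap.ker (s i))) n := by
      intro i
      have : Projective (ModuleCat.of R (M i →₀ R)) :=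
        (IsProjective.iff_projective _).1 inferInstance
      exact (LinearMap.shortExact_shortComplexKer (hs i)).hasProjectiveDimensionLT_X₁ (n + 1)
        (hasProjectiveDimensionLT_of_ge _ 1 _ (by omega)) (hM i)
    exact hasProjectiveDimensionLE_succ_directSum (f := fun i => (LinearMap.ker (s i)).subtype)
      (fun i => Subtype.val_injective) hs (fun i => (s i).exact_subtype_ker_map) (ih _ hK)

end FlatDimension

/-! ### Functions with finitely many values form a free module -/

section Nobeling

variable (k : Type u) [CommRing k] (G : Type v)

/-- Functions on `G` with finitely many values are the locally constant functions on the profinite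
space of ultrafilters on `G`; those with values in `ℤ` form a free group by Nöbeling's theorem. -/
theorem free_B_int : Module.Free ℤ (B ℤ G) := by
  let S : Profinite.{v} := Profinite.of (Ultrafilter G)
  let φ : LocallyConstant S ℤ →+ B ℤ G :=
    { toFun := fun f => ⟨fun x => f (pure x : Ultrafilter G),
        f.range_finite.subset (by rintro _ ⟨x, rfl⟩; exact ⟨_, rfl⟩)⟩
      map_zero' := rfl
      map_add' := fun _ _ => rfl }
  have hφ : Function.Bijective φ := by
    constructor
    · intro f g hfg
      refine LocallyConstant.coe_injective (denseRange_pure.equalizer f.continuous g.continuous ?_)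
      funext x
      exact congrFun (congrArg Subtype.val hfg) x
    · intro f
      have : Finite (Set.range f.1) := f.2
      let F : Ultrafilter G → Set.range f.1 := Ultrafilter.extend fun x => ⟨f.1 x, x, rfl⟩
      have hF : Continuous F := continuous_ultrafilter_extend _
      let F' : LocallyConstant S (Set.range f.1) := ⟨F, IsLocallyConstant.iff_continuous _ |>.2 hF⟩
      refine ⟨F'.map Subtype.val, Subtype.ext (funext fun x => ?_)⟩
      change (F (pure x)).1 = _
      rw [show F (pure x) = _ from congrFun (ultrafilter_extend_extends _) x]
  let e : LocallyConstant S ℤ ≃+ B ℤ G := AddEquiv.ofBijective φ hφ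
  have := LocallyConstant.freeOfProfinite S
  exact Module.Free.of_equiv e.toIntLinearEquiv

/-- Base change of functions from `ℤ` to `k`. -/
def castB : B ℤ G →+ B k G where
  toFun f := ⟨fun x => (f.1 x : k), (f.2.image (Int.cast : ℤ → k)).subset
    (by rintro _ ⟨x, rfl⟩; exact ⟨_, ⟨x, rfl⟩, rfl⟩)⟩
  map_zero' := Subtype.ext (funext fun _ => Int.cast_zero)
  map_add' _ _ := Subtype.ext (funext fun _ => Int.cast_add _ _)

variable {G} in
open Classical in
/-- The characteristic function of a set. -/
def indicatorB (A : Set G) : B k G :=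
  ⟨fun x => if x ∈ A then 1 else 0, (Set.toFinite {0, 1}).subset (by
    rintro _ ⟨x, rfl⟩
    by_cases h : x ∈ A <;> simp [h])⟩

variable {G} in
theorem indicatorB_apply (A : Set G) (x : G) [Decidable (x ∈ A)] :
    (indicatorB k A).1 x = if x ∈ A then 1 else 0 := by
  by_cases h : x ∈ A <;> simp [indicatorB, h]

variable {G} in
theorem castB_indicatorB (A : Set G) : castB k G (indicatorB ℤ A) = indicatorB k A := by
  classical
  refine Subtype.ext (funext fun x => ?_)
  change (((indicatorB ℤ A).1 x : ℤ) : k) = (indicatorB k A).1 x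
  rw [indicatorB_apply, indicatorB_apply]
  split_ifs <;> simp

variable {k G} in
theorem coeFn_sum_B {ι : Type*} (s : Finset ι) (f : ι → B k G) (x : G) :
    (∑ i ∈ s, f i).1 x = ∑ i ∈ s, (f i).1 x := by
  rw [Submodule.coe_sum, Finset.sum_apply]

variable {k G} in
/-- Finitely many functions with finitely many values are simultaneously interpolated from
finitely many points. -/
theorem exists_interpolation (s : Finset (B k G)) :
    ∃ (X : Finset G) (e : G → Set G), ∀ f ∈ s, f = ∑ x ∈ X, f.1 x • indicatorB k (e x) := by
  classical
  let Ψ : G → (s → k) := fun y f => f.1.1 y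
  have hfin : (Set.range Ψ).Finite := by
    refine (Set.Finite.pi' fun f : s => f.1.2).subset ?_
    rintro _ ⟨y, rfl⟩ f
    exact ⟨y, rfl⟩
  obtain ⟨X, -, hX⟩ := Set.exists_subset_bijOn (Set.univ : Set G) Ψ
  rw [Set.image_univ] at hX
  have hXf : X.Finite := (Set.finite_image_iff hX.injOn).1 (hX.image_eq ▸ hfin)
  refine ⟨hXf.toFinset, fun x => {y | Ψ y = Ψ x}, fun f hf => Subtype.ext (funext fun y => ?_)⟩
  rw [coeFn_sum_B]
  obtain ⟨x, hx, hxy⟩ := hX.surjOn ⟨y, rfl⟩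
  rw [Finset.sum_eq_single x]
  · change f.1 y = f.1 x * (indicatorB k {y | Ψ y = Ψ x}).1 y
    rw [indicatorB_apply, if_pos (show y ∈ {y | Ψ y = Ψ x} from hxy.symm), mul_one]
    exact (congrFun hxy ⟨f, hf⟩).symm
  · intro x' hx' hne
    change f.1 x' * (indicatorB k {y | Ψ y = Ψ x'}).1 y = 0
    rw [indicatorB_apply, if_neg, mul_zero]
    intro h
    exact hne (hX.injOn (hXf.mem_toFinset.1 hx') hx (h.symm.trans hxy.symm))
  · intro h
    exact absurd (hXf.mem_toFinset.2 hx) h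

/-- A `ℤ`-basis of `B ℤ G` remains a basis over `k`. -/
instance free_B : Module.Free k (B k G) := by
  classical
  have := free_B_int G
  let β := Module.Free.chooseBasis ℤ (B ℤ G)
  have hcast : ∀ h : B ℤ G, castB k G h =
      (β.repr h).sum fun i n => (n : k) • castB k G (β i) := by
    intro h
    conv_lhs => rw [← β.linearCombination_repr h]
    rw [Finsupp.linearCombination_apply, Finsupp.sum, Finsupp.sum, map_sum]
    refine Finset.sum_congr rfl fun i _ => ?_
    rw [map_zsmul]
    exact (Int.cast_smul_eq_zsmul k _ _).symm
  have hli : LinearIndependent k fun i => castB k G (β i) := by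
    rw [linearIndependent_iff']
    intro s c hc l hl
    -- on finitely many basis elements, the coordinate functions are integral combinations of
    -- evaluations at points, and such combinations make sense over `k`
    obtain ⟨X, e, hX⟩ := exists_interpolation (s.image β)
    have h1 : ∀ i ∈ s, ∑ x ∈ X, (β i).1 x * β.repr (indicatorB ℤ (e x)) l =
        if i = l then 1 else 0 := by
      intro i hi
      have := congrArg (fun f => β.repr f l) (hX _ (Finset.mem_image_of_mem _ hi))
      simp only [Module.Basis.repr_self, map_sum, map_smul, Finsupp.finsetSum_apply,
        Finsupp.smul_apply, smul_eq_mul, Finsupp.single_apply] at this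
      exact this.symm
    have h2 : ∀ x, ∑ i ∈ s, c i * ((β i).1 x : k) = 0 := by
      intro x
      have := congrArg (fun f => f.1 x) hc
      simp only [coeFn_sum_B] at this
      exact this
    calc c l = ∑ i ∈ s, c i * ((if i = l then 1 else 0 : ℤ) : k) := by
          simp [Finset.sum_ite_eq', hl]
      _ = ∑ i ∈ s, ∑ x ∈ X, c i * ((β i).1 x : k) * (β.repr (indicatorB ℤ (e x)) l : k) := by
          refine Finset.sum_congr rfl fun i hi => ?_
          rw [← h1 i hi, Int.cast_sum, Finset.mul_sum]
          exact Finset.sum_congr rfl fun x _ => by rw [Int.cast_mul, mul_assoc]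
      _ = 0 := by
          rw [Finset.sum_comm]
          exact Finset.sum_eq_zero fun x _ => by rw [← Finset.sum_mul, h2, zero_mul]
  have hsp : ⊤ ≤ Submodule.span k (Set.range fun i => castB k G (β i)) := by
    intro f _
    obtain ⟨X, e, hX⟩ := exists_interpolation {f}
    rw [hX f (Finset.mem_singleton_self f)]
    refine Submodule.sum_mem _ fun x _ => Submodule.smul_mem _ _ ?_
    rw [← castB_indicatorB, hcast]
    exact Submodule.finsuppSum_mem _ _ _ _ fun i _ =>
      Submodule.smul_mem _ _ (Submodule.subset_span ⟨i, rfl⟩)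
  exact Module.Free.of_basis (Module.Basis.mk hli hsp)

end Nobeling

/-! ### The diagonal tensor product with `B` -/

section TensorB

variable {k : Type u} [CommRing k] {G : Type v}

/-- The constant function with value one. -/
def oneB : B k G :=
  ⟨fun _ => 1, (Set.finite_singleton (1 : k)).subset (by rintro _ ⟨_, rfl⟩; rfl)⟩

/-- Pointwise multiplication on `B`. -/
def mulB : B k G →+ B k G →+ B k G :=
  AddMonoidHom.mk' (fun b => AddMonoidHom.mk' (fun b' => ⟨fun x => b.1 x * b'.1 x, by
      refine (b.2.image2 (· * ·) b'.2).subset ?_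
      rintro _ ⟨x, rfl⟩
      exact ⟨_, ⟨x, rfl⟩, _, ⟨x, rfl⟩, rfl⟩⟩)
    fun _ _ => Subtype.ext (funext fun _ => mul_add _ _ _))
    fun _ _ => AddMonoidHom.ext fun _ => Subtype.ext (funext fun _ => add_mul _ _ _)

theorem mulB_oneB (b : B k G) : mulB oneB b = b :=
  Subtype.ext (funext fun _ => one_mul _)

theorem mulB_smul_comm (c : k) (b b' : B k G) : mulB (c • b) b' = mulB b (c • b') :=
  Subtype.ext (funext fun x => by
    change c * b.1 x * b'.1 x = b.1 x * (c * b'.1 x)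
    ring)

variable [Group G]

variable (k G) in
/-- The module `M ⊗ B` with the diagonal action, for an unbundled module `M`. -/
abbrev TB (M : Type (max u v)) [AddCommGroup M] [Module k[G] M] : Type (max u v) :=
  tensorB (ModuleCat.of k[G] M)

variable {M : Type (max u v)} [AddCommGroup M] [Module k[G] M]
variable {N : Type (max u v)} [AddCommGroup N] [Module k[G] N]
variable {L : Type (max u v)} [AddCommGroup L] [Module k[G] L]

/-- The pure tensors in `M ⊗ B`, as a biadditive map: `M` carries no `k`-module structure of its
own, and scalars of `k` act through `algebraMap k k[G]`. -/
def tmk : M →+ B k G →+ TB k G M :=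
  AddMonoidHom.mk' (fun m => AddMonoidHom.mk' (fun b =>
      ((m : RestrictScalars k k[G] M) ⊗ₜ[k] b : RestrictScalars k k[G] M ⊗[k] B k G))
    fun b b' => TensorProduct.tmul_add (R := k) (M := RestrictScalars k k[G] M) m b b')
    fun m m' => AddMonoidHom.ext fun b =>
      TensorProduct.add_tmul (R := k) (M := RestrictScalars k k[G] M) m m' b

theorem tmk_smul (c : k) (m : M) (b : B k G) :
    tmk (algebraMap k k[G] c • m) b = tmk m (c • b) :=
  TensorProduct.smul_tmul (R := k) (M := RestrictScalars k k[G] M) c m b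

theorem algebraMap_smul_tmk (c : k) (m : M) (b : B k G) :
    algebraMap k k[G] c • tmk m b = tmk (algebraMap k k[G] c • m) b :=
  (Representation.asModuleEquiv_symm_map_smul
    ((Rep.ofModuleMonoidAlgebra.obj (ModuleCat.of k[G] M)).ρ.tprod (bRep k G)) c
    ((m : RestrictScalars k k[G] M) ⊗ₜ[k] b)).symm

theorem of_smul_tmk (g : G) (m : M) (b : B k G) :
    MonoidAlgebra.of k G g • tmk m b = tmk (MonoidAlgebra.of k G g • m) (bRep k G g b) :=
  (Representation.asModuleEquiv_symm_map_rho
    ((Rep.ofModuleMonoidAlgebra.obj (ModuleCat.of k[G] M)).ρ.tprod (bRep k G)) g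
    ((m : RestrictScalars k k[G] M) ⊗ₜ[k] b)).symm

theorem single_smul_tmk (g : G) (c : k) (m : M) (b : B k G) :
    MonoidAlgebra.single g c • tmk m b = tmk (MonoidAlgebra.single g c • m) (bRep k G g b) := by
  have h : (MonoidAlgebra.single g c : k[G]) = algebraMap k k[G] c * MonoidAlgebra.of k G g := by
    simp
  rw [h, mul_smul, mul_smul, of_smul_tmk, algebraMap_smul_tmk]

theorem TB.induction_on {motive : TB k G M → Prop} (z : TB k G M) (zero : motive 0)
    (tmk : ∀ m b, motive (tmk m b)) (add : ∀ x y, motive x → motive y → motive (x + y)) :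
    motive z := by
  have H : ∀ z : RestrictScalars k k[G] M ⊗[k] B k G, motive z := fun z => by
    induction z using TensorProduct.induction_on with
    | zero => exact zero
    | tmul m b => exact tmk m b
    | add x y hx hy => exact add x y hx hy
  exact H z

theorem TB.hom_ext {f g : TB k G M →ₗ[k[G]] N} (h : ∀ m b, f (tmk m b) = g (tmk m b)) :
    f = g := by
  ext z
  induction z using TB.induction_on with
  | zero => simp
  | tmk m b => exact h m b
  | add x y hx hy => rw [map_add, map_add, hx, hy]

/-- The universal property of `M ⊗ B` for additive maps that are balanced over `k`. -/
def TB.liftAdd {A : Type*} [AddCommGroup A] (f : M →+ B k G →+ A)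
    (hf : ∀ (c : k) m b, f (algebraMap k k[G] c • m) b = f m (c • b)) : TB k G M →+ A :=
  TensorProduct.liftAddHom (R := k) (M := RestrictScalars k k[G] M) f hf

theorem TB.liftAdd_tmk {A : Type*} [AddCommGroup A] (f : M →+ B k G →+ A)
    (hf : ∀ (c : k) m b, f (algebraMap k k[G] c • m) b = f m (c • b)) (m : M) (b : B k G) :
    TB.liftAdd f hf (tmk m b) = f m b := rfl

/-- The equivariant universal property of `M ⊗ B`. -/
def TB.lift (f : M →+ B k G →+ N)
    (hf : ∀ (c : k) m b, f (algebraMap k k[G] c • m) b = f m (c • b))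
    (hs : ∀ (g : G) (c : k) m b, f ((MonoidAlgebra.single g c : k[G]) • m) (bRep k G g b) =
      (MonoidAlgebra.single g c : k[G]) • f m b) : TB k G M →ₗ[k[G]] N where
  toFun := TB.liftAdd f hf
  map_add' := map_add _
  map_smul' r z := by
    rw [RingHom.id_apply]
    induction r using MonoidAlgebra.induction_linear with
    | zero => simp
    | add r s hr hs => rw [add_smul, add_smul, map_add, hr, hs]
    | single g c =>
      induction z using TB.induction_on with
      | zero => simp
      | tmk m b => rw [single_smul_tmk, TB.liftAdd_tmk, TB.liftAdd_tmk, hs]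
      | add x y hx hy => rw [smul_add, map_add, map_add, smul_add, hx, hy]

/-- The functor `_ ⊗ B` on morphisms. -/
def TB.map (φ : M →ₗ[k[G]] N) : TB k G M →ₗ[k[G]] TB k G N :=
  TB.lift (tmk.comp φ.toAddMonoidHom)
    (fun c m b => by
      change tmk (φ _) b = tmk (φ m) _
      rw [map_smul, tmk_smul])
    (fun g c m b => by
      change tmk (φ _) _ = _ • tmk (φ m) b
      rw [map_smul, single_smul_tmk])

@[simp]
theorem TB.map_tmk (φ : M →ₗ[k[G]] N) (m : M) (b : B k G) :
    TB.map φ (tmk m b) = tmk (φ m) b := rfl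

theorem TB.map_comp (ψ : N →ₗ[k[G]] L) (φ : M →ₗ[k[G]] N) :
    TB.map (ψ.comp φ) = (TB.map ψ).comp (TB.map φ) :=
  TB.hom_ext fun _ _ => rfl

theorem TB.map_id : TB.map (LinearMap.id : M →ₗ[k[G]] M) = LinearMap.id :=
  TB.hom_ext fun _ _ => rfl

theorem TB.map_map (ψ : N →ₗ[k[G]] L) (φ : M →ₗ[k[G]] N) (z : TB k G M) :
    TB.map ψ (TB.map φ z) = TB.map (ψ.comp φ) z := by rw [TB.map_comp]; rfl

/-- A `kG`-linear map, viewed as a `k`-linear map. -/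
def restrictK (φ : M →ₗ[k[G]] N) : RestrictScalars k k[G] M →ₗ[k] RestrictScalars k k[G] N where
  toFun := φ
  map_add' := φ.map_add
  map_smul' c x := φ.map_smul (algebraMap k k[G] c) x

theorem TB.coe_map (φ : M →ₗ[k[G]] N) :
    ⇑(TB.map φ) = ⇑((restrictK φ).rTensor (B k G)) := by
  funext z
  induction z using TB.induction_on with
  | zero => exact (map_zero (TB.map φ)).trans (map_zero ((restrictK φ).rTensor (B k G))).symm
  | tmk m b => rfl
  | add x y hx hy =>
    exact (map_add (TB.map φ) x y).trans
      ((congrArg₂ (· + ·) hx hy).trans (map_add ((restrictK φ).rTensor (B k G)) x y).symm)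

theorem TB.map_injective {φ : M →ₗ[k[G]] N} (h : Function.Injective φ) :
    Function.Injective (TB.map φ) := by
  rw [TB.coe_map]
  exact Module.Flat.rTensor_preserves_injective_linearMap (restrictK φ) h

theorem TB.map_surjective {φ : M →ₗ[k[G]] N} (h : Function.Surjective φ) :
    Function.Surjective (TB.map φ) := by
  rw [TB.coe_map]
  exact LinearMap.rTensor_surjective _ (g := restrictK φ) h

theorem TB.map_exact {φ : M →ₗ[k[G]] N} {ψ : N →ₗ[k[G]] L} (h : Function.Exact φ ψ) :
    Function.Exact (TB.map φ) (TB.map ψ) := by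
  rw [TB.coe_map, TB.coe_map]
  exact @Module.Flat.rTensor_exact k (B k G) _ _ _ _ (RestrictScalars k k[G] M)
    (RestrictScalars k k[G] N) (RestrictScalars k k[G] L) _ _ _
    (RestrictScalars.module k k[G] M) (RestrictScalars.module k k[G] N)
    (RestrictScalars.module k k[G] L) (restrictK φ) (restrictK ψ) h

variable (k G M) in
/-- The map `M → M ⊗ B` induced by the constant function with value one. -/
def TB.unit : M →ₗ[k[G]] TB k G M where
  toFun m := tmk m oneB
  map_add' m m' := by rw [map_add]; rfl
  map_smul' r m := by
    rw [RingHom.id_apply]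
    induction r using MonoidAlgebra.induction_linear with
    | zero => simp
    | add r s hr hs => rw [add_smul, add_smul, map_add, AddMonoidHom.add_apply, hr, hs]
    | single g c => rw [single_smul_tmk]; rfl

theorem TB.unit_apply (m : M) : TB.unit k G M m = tmk m oneB := rfl

theorem TB.map_unit (φ : M →ₗ[k[G]] N) (m : M) :
    TB.map φ (TB.unit k G M m) = TB.unit k G N (φ m) := rfl

variable (k G M) in
theorem TB.unit_injective : Function.Injective (TB.unit k G M) := by
  -- evaluation at `1 : G` is an additive retraction
  let r : TB k G M →+ M := TB.liftAdd
    (AddMonoidHom.mk' (fun m => AddMonoidHom.mk' (fun b => algebraMap k k[G] (b.1 1) • m)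
      fun b b' => by
        change algebraMap k k[G] (b.1 1 + b'.1 1) • m = _
        rw [map_add, add_smul])
      fun m m' => AddMonoidHom.ext fun b => smul_add _ m m')
    (fun c m b => by
      change algebraMap k k[G] (b.1 1) • algebraMap k k[G] c • m =
        algebraMap k k[G] (c * b.1 1) • m
      rw [smul_smul, ← map_mul, mul_comm])
  refine Function.LeftInverse.injective (g := r) fun m => ?_
  change algebraMap k k[G] 1 • m = m
  rw [map_one, one_smul]

/-- The triadditive map `(m, b, b') ↦ m ⊗ b b'`. -/
def tmkMul : M →+ B k G →+ B k G →+ TB k G M :=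
  AddMonoidHom.mk' (fun m => AddMonoidHom.mk' (fun b => (tmk (k := k) (G := G) m).comp (mulB b))
    fun b b' => AddMonoidHom.ext fun b'' => by
      change tmk (k := k) (G := G) m (mulB (b + b') b'') =
        tmk (k := k) (G := G) m (mulB b b'') + tmk (k := k) (G := G) m (mulB b' b'')
      rw [map_add, AddMonoidHom.add_apply, map_add])
    fun m m' => AddMonoidHom.ext fun b => AddMonoidHom.ext fun b' => by
      change tmk (k := k) (G := G) (m + m') (mulB b b') =
        tmk (k := k) (G := G) m (mulB b b') + tmk (k := k) (G := G) m' (mulB b b')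
      rw [map_add, AddMonoidHom.add_apply]

theorem tmkMul_apply (m : M) (b b' : B k G) :
    tmkMul (k := k) (G := G) m b b' = tmk (k := k) (G := G) m (mulB b b') := rfl

/-- The additive map `(m ⊗ b, b') ↦ m ⊗ b b'`. -/
def TB.mulAdd : TB k G M →+ B k G →+ TB k G M :=
  TB.liftAdd (k := k) (G := G) (M := M) tmkMul (fun c m b => AddMonoidHom.ext fun b' => by
    rw [tmkMul_apply, tmkMul_apply, tmk_smul]
    exact congrArg (tmk (k := k) (G := G) m) (Subtype.ext (funext fun x =>
      (mul_assoc c (b.1 x) (b'.1 x)).symm)))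

theorem TB.mulAdd_tmk (m : M) (b b' : B k G) :
    TB.mulAdd (tmk (k := k) (G := G) m b) b' = tmk (k := k) (G := G) m (mulB b b') := rfl

theorem TB.mulAdd_smul (c : k) (z : TB k G M) (b : B k G) :
    TB.mulAdd (algebraMap k k[G] c • z) b = TB.mulAdd z (c • b) := by
  induction z using TB.induction_on with
  | zero => rw [smul_zero, map_zero, AddMonoidHom.zero_apply, AddMonoidHom.zero_apply]
  | tmk m b' => rw [algebraMap_smul_tmk, tmk_smul, mulAdd_tmk, mulAdd_tmk, mulB_smul_comm]
  | add x y hx hy =>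
    rw [smul_add, map_add, map_add, AddMonoidHom.add_apply, AddMonoidHom.add_apply, hx, hy]

theorem TB.mulAdd_single_smul (g : G) (c : k) (z : TB k G M) (b : B k G) :
    TB.mulAdd ((MonoidAlgebra.single g c : k[G]) • z) (bRep k G g b) =
      (MonoidAlgebra.single g c : k[G]) • TB.mulAdd z b := by
  induction z using TB.induction_on with
  | zero => rw [smul_zero, map_zero, AddMonoidHom.zero_apply, AddMonoidHom.zero_apply, smul_zero]
  | tmk m b' =>
    rw [single_smul_tmk, mulAdd_tmk, mulAdd_tmk, single_smul_tmk]
    rfl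
  | add x y hx hy =>
    rw [smul_add, map_add, map_add, AddMonoidHom.add_apply, AddMonoidHom.add_apply, hx, hy,
      smul_add]

variable (k G M) in
/-- The retraction `(m ⊗ b) ⊗ b' ↦ m ⊗ b b'` of the map `TB.map (TB.unit k G M)`. -/
def TB.mul : TB k G (TB k G M) →ₗ[k[G]] TB k G M :=
  TB.lift (k := k) (G := G) (M := TB k G M) TB.mulAdd TB.mulAdd_smul TB.mulAdd_single_smul

theorem TB.mul_map_unit (z : TB k G M) : TB.mul k G M (TB.map (TB.unit k G M) z) = z := by
  have : (TB.mul k G M).comp (TB.map (TB.unit k G M)) = LinearMap.id :=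
    TB.hom_ext fun m b => congrArg (tmk (k := k) (G := G) m) (mulB_oneB b)
  exact LinearMap.congr_fun this z

end TensorB

/-! ### Tensor products of projective modules with `B` -/

section TensorProjective

/-- A property of modules that is inherited by direct sums and by direct summands holds for all
projective modules as soon as it holds for the ring. -/
theorem projective_induction {R : Type u} [Ring R]
    (p : ∀ (M : Type u) [AddCommGroup M] [Module R M], Prop) (h₁ : p R)
    (h₂ : ∀ {ι : Type u} (M : ι → Type u) [∀ i, AddCommGroup (M i)] [∀ i, Module R (M i)],
      (∀ i, p (M i)) → p (⨁ i, M i))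
    (h₃ : ∀ {M N : Type u} [AddCommGroup M] [Module R M] [AddCommGroup N] [Module R N]
      (i : M →ₗ[R] N) (r : N →ₗ[R] M), (∀ x, r (i x) = x) → p N → p M)
    (P : Type u) [AddCommGroup P] [Module R P] [Module.Projective R P] : p P := by
  classical
  obtain ⟨s, hs⟩ := Module.Projective.out (R := R) (P := P)
  let e : (P →₀ R) ≃ₗ[R] ⨁ _ : P, R := finsuppLEquivDirectSum R R P
  refine h₃ (e.toLinearMap.comp s)
    ((Finsupp.linearCombination R id).comp e.symm.toLinearMap) (fun x => ?_) (h₂ _ fun _ => h₁)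
  change Finsupp.linearCombination R id (e.symm (e (s x))) = x
  rw [e.symm_apply_apply, hs]

variable {k : Type u} [CommRing k] {G : Type v} [Group G]
variable {N : Type (max u v)} [AddCommGroup N] [Module k[G] N]

/-- `kG ⊗ B` is induced from the `k`-module `B`: equivariant maps out of it correspond to
`k`-linear maps out of `B`. -/
theorem TB.exists_map_of_groupAlgebra (ψ : B k G →+ N)
    (hψ : ∀ (c : k) b, ψ (c • b) = algebraMap k k[G] c • ψ b) :
    ∃ Φ : TB k G k[G] →ₗ[k[G]] N, ∀ (g : G) (c : k) (b : B k G),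
      Φ (tmk (MonoidAlgebra.single g c : k[G]) b) =
        (MonoidAlgebra.single g c : k[G]) • ψ (bRep k G g⁻¹ b) := by
  let F₀ : G → k →+ B k G →+ N := fun g =>
    AddMonoidHom.mk' (fun c : k => AddMonoidHom.mk' (fun b : B k G =>
      (MonoidAlgebra.single g c : k[G]) • ψ (bRep k G g⁻¹ b))
      fun b b' => by rw [map_add, map_add, smul_add])
      fun c c' => AddMonoidHom.ext fun b => by
        change (MonoidAlgebra.single g (c + c') : k[G]) • ψ (bRep k G g⁻¹ b) =
          (MonoidAlgebra.single g c : k[G]) • ψ (bRep k G g⁻¹ b) +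
          (MonoidAlgebra.single g c' : k[G]) • ψ (bRep k G g⁻¹ b)
        rw [MonoidAlgebra.single_add, add_smul]
  let F : k[G] →+ B k G →+ N :=
    (Finsupp.liftAddHom F₀).comp MonoidAlgebra.coeffAddEquiv.toAddMonoidHom
  have hF : ∀ (g : G) (c : k) (b : B k G), F (MonoidAlgebra.single g c) b =
      (MonoidAlgebra.single g c : k[G]) • ψ (bRep k G g⁻¹ b) := by
    intro g c b
    change Finsupp.liftAddHom F₀ (Finsupp.single g c) b = _
    rw [Finsupp.liftAddHom_apply_single]
    rfl
  refine ⟨TB.lift F (fun c x b => ?_) (fun g c x b => ?_), fun g c b => hF g c b⟩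
  · induction x using MonoidAlgebra.induction_linear with
    | zero => rw [smul_zero, map_zero, AddMonoidHom.zero_apply, AddMonoidHom.zero_apply]
    | add x y hx hy =>
      rw [smul_add, map_add, map_add, AddMonoidHom.add_apply, AddMonoidHom.add_apply, hx, hy]
    | single g c' =>
      have h1 : algebraMap k k[G] c • (MonoidAlgebra.single g c' : k[G]) =
          MonoidAlgebra.single g (c * c') := by simp
      rw [h1, hF, hF, map_smul, hψ, smul_smul]
      congr 1
      simp [mul_comm]
  · induction x using MonoidAlgebra.induction_linear with
    | zero => rw [smul_zero, map_zero, AddMonoidHom.zero_apply, AddMonoidHom.zero_apply, smul_zero]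
    | add x y hx hy =>
      rw [smul_add, map_add, map_add, AddMonoidHom.add_apply, AddMonoidHom.add_apply, hx, hy,
        smul_add]
    | single g' c' =>
      have h1 : (MonoidAlgebra.single g c : k[G]) • (MonoidAlgebra.single g' c' : k[G]) =
          MonoidAlgebra.single (g * g') (c * c') := by
        rw [smul_eq_mul, MonoidAlgebra.single_mul_single]
      have h2 : bRep k G (g * g')⁻¹ (bRep k G g b) = bRep k G g'⁻¹ b := by
        rw [← Module.End.mul_apply, ← map_mul]
        congr 2
        group
      rw [h1, hF, hF, h2, ← h1, smul_eq_mul, mul_smul]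

/-- The functor `_ ⊗ B` commutes with direct sums; a retraction is all that is needed. -/
theorem TB.exists_retract_directSum {ι : Type (max u v)} (M : ι → Type (max u v))
    [∀ i, AddCommGroup (M i)] [∀ i, Module k[G] (M i)] :
    ∃ (s : TB k G (⨁ i, M i) →ₗ[k[G]] ⨁ i, TB k G (M i))
      (r : (⨁ i, TB k G (M i)) →ₗ[k[G]] TB k G (⨁ i, M i)),
      (∀ x, r (s x) = x) ∧ ∀ x i, s (TB.unit k G _ x) i = TB.unit k G (M i) (x i) := by
  classical
  let F : (⨁ i, M i) →+ B k G →+ ⨁ i, TB k G (M i) :=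
    AddMonoidHom.flip (AddMonoidHom.mk' (fun b => DirectSum.map fun i =>
      (tmk (k := k) (G := G) (M := M i)).flip b) fun b b' => by
        ext i x j
        simp)
  have hF : ∀ x b i, F x b i = tmk (k := k) (G := G) (x i) b := fun x b i => rfl
  let s : TB k G (⨁ i, M i) →ₗ[k[G]] ⨁ i, TB k G (M i) := TB.lift F
    (fun c x b => DirectSum.ext_component k[G] fun i => by
      change F _ _ i = F _ _ i
      rw [hF, hF]
      exact tmk_smul c (x i) b)
    (fun g c x b => DirectSum.ext_component k[G] fun i => by
      change F _ _ i = (MonoidAlgebra.single g c : k[G]) • F _ _ i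
      rw [hF, hF]
      exact (single_smul_tmk g c (x i) b).symm)
  let r : (⨁ i, TB k G (M i)) →ₗ[k[G]] TB k G (⨁ i, M i) :=
    DirectSum.toModule k[G] ι _ fun i => TB.map (DirectSum.lof k[G] ι M i)
  refine ⟨s, r, fun z => ?_, fun x i => rfl⟩
  have : r.comp s = LinearMap.id := by
    refine TB.hom_ext fun x b => ?_
    change r (F x b) = tmk x b
    induction x using DirectSum.induction_on with
    | zero => rw [map_zero, map_zero, AddMonoidHom.zero_apply, AddMonoidHom.zero_apply, map_zero]
    | add x y hx hy =>
      rw [map_add, map_add, AddMonoidHom.add_apply, AddMonoidHom.add_apply, map_add, hx, hy]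
    | of i x =>
      have h1 : F (DirectSum.of M i x) b = DirectSum.lof k[G] ι (fun i => TB k G (M i)) i
          (tmk (k := k) (G := G) x b) := by
        change DirectSum.map _ (DirectSum.of M i x) = _
        rw [DirectSum.map_of]
        rfl
      rw [h1, DirectSum.toModule_lof, TB.map_tmk]
      rfl
  exact LinearMap.congr_fun this z

/-- The tensor product `P ⊗ B` is projective for `P` projective: `kG ⊗ B` is induced from the free
`k`-module `B`. -/
instance projective_TB (P : Type (max u v)) [AddCommGroup P] [Module k[G] P]
    [Module.Projective k[G] P] : Module.Projective k[G] (TB k G P) := by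
  classical
  refine projective_induction (R := k[G])
    (fun M _ _ => Module.Projective k[G] (TB k G M)) ?_ ?_ ?_ P
  · refine Module.Projective.of_lifting_property'' fun f hf => ?_
    let β := Module.Free.chooseBasis k (B k G)
    choose n hn using fun i => hf (tmk (1 : k[G]) (β i))
    let ψ := β.constr ℕ n
    have hψ : ∀ (c : k) b, ψ (c • b) = algebraMap k k[G] c • ψ b := fun c b => by
      rw [map_smul, algebraMap_smul]
    have hfψ : ∀ b, f (ψ b) = tmk (1 : k[G]) b := by
      intro b
      induction β.mem_span b using Submodule.span_induction with
      | mem b hb =>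
        obtain ⟨i, rfl⟩ := hb
        rw [Module.Basis.constr_basis, hn]
      | zero => rw [map_zero, map_zero, map_zero]
      | add b b' _ _ hb hb' => rw [map_add, map_add, map_add, hb, hb']
      | smul c b _ hb => rw [hψ, map_smul, hb, algebraMap_smul_tmk, tmk_smul]
    obtain ⟨Φ, hΦ⟩ := TB.exists_map_of_groupAlgebra (k := k) (G := G) ψ.toAddMonoidHom hψ
    refine ⟨Φ, TB.hom_ext fun x b => ?_⟩
    change f (Φ (tmk x b)) = tmk x b
    induction x using MonoidAlgebra.induction_linear with
    | zero => simp only [map_zero, AddMonoidHom.zero_apply]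
    | add x y hx hy => simp only [map_add, AddMonoidHom.add_apply, hx, hy]
    | single g c =>
      rw [hΦ, map_smul]
      change _ • f (ψ _) = _
      rw [hfψ, single_smul_tmk, smul_eq_mul, mul_one, Representation.self_inv_apply]
  · intro ι M _ _ hM
    obtain ⟨s, r, hrs, -⟩ := TB.exists_retract_directSum (k := k) (G := G) M
    exact Module.Projective.of_split s r (LinearMap.ext hrs)
  · intro M N _ _ _ _ i r hri hN
    exact Module.Projective.of_split (TB.map i) (TB.map r) (LinearMap.ext fun x => by
      change TB.map r (TB.map i x) = x
      rw [TB.map_map, show r.comp i = LinearMap.id from LinearMap.ext hri, TB.map_id]; rfl)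

/-- For a projective module `P` the map `P → P ⊗ B` is split. For `P = kG`, a retraction is
`g ⊗ b ↦ b(g) g`. -/
theorem TB.exists_retraction_unit (P : Type (max u v)) [AddCommGroup P] [Module k[G] P]
    [Module.Projective k[G] P] :
    ∃ ρ : TB k G P →ₗ[k[G]] P, ∀ x, ρ (TB.unit k G P x) = x := by
  classical
  refine projective_induction (R := k[G])
    (fun M _ _ => ∃ ρ : TB k G M →ₗ[k[G]] M, ∀ x, ρ (TB.unit k G M x) = x) ?_ ?_ ?_ P
  · obtain ⟨Φ, hΦ⟩ := TB.exists_map_of_groupAlgebra (k := k) (G := G) (N := k[G])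
      (AddMonoidHom.mk' (fun b => algebraMap k k[G] (b.1 1))
        fun b b' => map_add (algebraMap k k[G]) _ _)
      (fun c b => map_mul (algebraMap k k[G]) _ _)
    refine ⟨Φ, fun x => ?_⟩
    induction x using MonoidAlgebra.induction_linear with
    | zero => rw [map_zero, map_zero]
    | add x y hx hy => rw [map_add, map_add, hx, hy]
    | single g c =>
      rw [TB.unit_apply, hΦ]
      change _ * algebraMap k k[G] 1 = _
      rw [map_one, mul_one]
  · intro ι M _ _ hM
    choose ρ hρ using hM
    obtain ⟨s, -, -, hs⟩ := TB.exists_retract_directSum (k := k) (G := G) M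
    refine ⟨(DirectSum.lmap ρ).comp s, fun x => DirectSum.ext_component k[G] fun i => ?_⟩
    change ρ i (s (TB.unit k G _ x) i) = x i
    rw [hs, hρ]
  · rintro M N _ _ _ _ i r hri ⟨ρ, hρ⟩
    refine ⟨r.comp (ρ.comp (TB.map i)), fun x => ?_⟩
    change r (ρ (TB.map i (TB.unit k G M x))) = x
    rw [TB.map_unit, hρ, hri]

end TensorProjective

/-! ### Splicing short exact sequences -/

section Splice

variable {R : Type u} [Ring R]

theorem acyclic_iff_exact (X : CochainComplex (ModuleCat.{u} R) ℤ) :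
    X.Acyclic ↔ ∀ i : ℤ, Function.Exact (X.d i (i + 1)) (X.d (i + 1) (i + 1 + 1)) := by
  have h : ∀ i : ℤ, X.ExactAt (i + 1) ↔
      Function.Exact (X.d i (i + 1)) (X.d (i + 1) (i + 1 + 1)) := by
    intro i
    rw [X.exactAt_iff' i (i + 1) (i + 1 + 1) (by simp) (by simp)]
    exact ShortComplex.ShortExact.moduleCat_exact_iff_function_exact _
  constructor
  · intro H i
    exact (h i).1 (H _)
  · intro H i
    obtain ⟨j, rfl⟩ : ∃ j, i = j + 1 := ⟨i - 1, by ring⟩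
    exact (h j).2 (H j)

/-- There is a short exact sequence `0 → A → P → C → 0` with `P` projective. -/
def IsSyzygy (A C : ModuleCat.{u} R) : Prop :=
  ∃ (P : ModuleCat.{u} R) (f : A ⟶ P) (g : P ⟶ C), Module.Projective R P ∧
    Function.Injective f ∧ Function.Surjective g ∧ Function.Exact f g

/-- If every module of a class has a syzygy and a cosyzygy in the class, then each of its modules
is a member of a two-sided sequence of successive syzygies in the class. -/
theorem exists_syzygy_sequence (p : ModuleCat.{u} R → Prop)
    (hr : ∀ M, p M → ∃ M', p M' ∧ IsSyzygy M M') (hl : ∀ M, p M → ∃ M', p M' ∧ IsSyzygy M' M)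
    (M : ModuleCat.{u} R) (hM : p M) :
    ∃ Z : ℤ → ModuleCat.{u} R, Z 0 = M ∧ ∀ i, p (Z i) ∧ IsSyzygy (Z i) (Z (i + 1)) := by
  choose r hr₁ hr₂ using hr
  choose l hl₁ hl₂ using hl
  let r' : Subtype p → Subtype p := fun M => ⟨r M.1 M.2, hr₁ _ _⟩
  let l' : Subtype p → Subtype p := fun M => ⟨l M.1 M.2, hl₁ _ _⟩
  let Z : ℤ → Subtype p
    | Int.ofNat n => r'^[n] ⟨M, hM⟩
    | Int.negSucc n => l'^[n + 1] ⟨M, hM⟩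
  have hZ : ∀ i, IsSyzygy (Z i).1 (Z (i + 1)).1 := by
    intro i
    rcases i with n | (_ | n)
    · have : Z (Int.ofNat n + 1) = r' (Z (Int.ofNat n)) :=
        Function.iterate_succ_apply' r' n _
      rw [this]
      exact hr₂ _ _
    · exact hl₂ M hM
    · have : Z (Int.negSucc (n + 1)) = l' (Z (Int.negSucc (n + 1) + 1)) :=
        Function.iterate_succ_apply' l' (n + 1) _
      rw [this]
      exact hl₂ _ _
  exact ⟨fun i => (Z i).1, rfl, fun i => ⟨(Z i).2, hZ i⟩⟩

/-- Let every module in a class `p` have a syzygy and a cosyzygy in `p`, and let maps from such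
modules to projective modules extend along monomorphisms with cokernel in `p`. Then the modules in
`p` are Gorenstein projective. -/
theorem gProj_of_syzygies (p : ModuleCat.{u} R → Prop)
    (hr : ∀ M, p M → ∃ M', p M' ∧ IsSyzygy M M') (hl : ∀ M, p M → ∃ M', p M' ∧ IsSyzygy M' M)
    (hext : ∀ (A E C : ModuleCat.{u} R) (f : A ⟶ E) (g : E ⟶ C), Function.Injective f →
      Function.Surjective g → Function.Exact f g → p C → ∀ (Q : ModuleCat.{u} R),
      Module.Projective R Q → ∀ a : A ⟶ Q, ∃ b : E ⟶ Q, f ≫ b = a)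
    (M : ModuleCat.{u} R) (hM : p M) : GProj R M := by
  obtain ⟨Z, hZ₀, hZ⟩ := exists_syzygy_sequence p hr hl M hM
  choose hp P f g hP hf hg hfg using hZ
  have hfg₀ : ∀ i, f i ≫ g i = 0 := fun i =>
    ModuleCat.hom_ext (LinearMap.ext fun x => (hfg i _).2 ⟨x, rfl⟩)
  have hgm : ∀ i, Epi (g i) := fun i => (ModuleCat.epi_iff_surjective _).2 (hg i)
  have hfm : ∀ i, Mono (f i) := fun i => (ModuleCat.mono_iff_injective _).2 (hf i)
  let X : CochainComplex (ModuleCat.{u} R) ℤ := CochainComplex.of P (fun i => g i ≫ f (i + 1))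
    (fun i => by rw [Category.assoc, reassoc_of% (hfg₀ (i + 1)), Limits.zero_comp,
      Limits.comp_zero])
  have hd : ∀ i, X.d i (i + 1) = g i ≫ f (i + 1) := fun i =>
    CochainComplex.of_d P (fun i => g i ≫ f (i + 1)) i
  have hexact : ∀ i, Function.Exact (g i ≫ f (i + 1)) (g (i + 1)) := by
    intro i x
    rw [hfg (i + 1) x]
    constructor
    · rintro ⟨y, rfl⟩
      obtain ⟨z, rfl⟩ := hg i y
      exact ⟨z, rfl⟩
    · rintro ⟨z, rfl⟩
      exact ⟨g i z, rfl⟩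
  -- `M = Z 0` is the cokernel of the differential `P (-2) → P (-1)`
  refine ⟨X, ⟨⟨hP, ?_⟩, ?_⟩, -2, ?_⟩
  · rw [acyclic_iff_exact]
    intro i x
    rw [hd, hd]
    refine Iff.trans ?_ (hexact i x)
    change f (i + 1 + 1) (g (i + 1) x) = 0 ↔ _
    exact map_eq_zero_iff (f (i + 1 + 1)).hom (hf _)
  · intro Q hQ i a ha
    rw [hd, Category.assoc] at ha
    have ha' : f (i + 1) ≫ a = 0 := by
      rw [← cancel_epi (g i), ha, Limits.comp_zero]
    have hS : (ShortComplex.mk (f (i + 1)) (g (i + 1)) (hfg₀ _)).Exact :=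
      (ShortComplex.ShortExact.moduleCat_exact_iff_function_exact _).2 (hfg (i + 1))
    obtain ⟨a', rfl⟩ : ∃ a', g (i + 1) ≫ a' = a := by
      have : Epi (ShortComplex.mk (f (i + 1)) (g (i + 1)) (hfg₀ _)).g := hgm _
      exact ⟨hS.desc a ha', hS.g_desc a ha'⟩
    obtain ⟨b, rfl⟩ :=
      hext _ _ _ (f (i + 1 + 1)) (g (i + 1 + 1)) (hf _) (hg _) (hfg _) (hp _) Q hQ a'
    exact ⟨b, by rw [hd, Category.assoc]⟩
  · let S := ShortComplex.mk (X.d (-2) (-2 + 1)) (g (-2 + 1)) (by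
      rw [hd, Category.assoc, hfg₀, Limits.comp_zero])
    have hS : S.Exact := (ShortComplex.ShortExact.moduleCat_exact_iff_function_exact _).2 (by
      change Function.Exact (X.d (-2) (-2 + 1)) (g (-2 + 1))
      rw [hd]
      exact hexact (-2))
    have : Epi S.g := hgm _
    exact ⟨(eqToIso (hZ₀.symm.trans (congrArg Z (by norm_num : (0 : ℤ) = -2 + 1 + 1)))).trans
      (Limits.IsColimit.coconePointUniqueUpToIso hS.gIsCokernel (Limits.colimit.isColimit _))⟩

end Splice

/-! ### Cofibrant modules are Gorenstein projective -/

section Cofibrant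

variable {k : Type u} [CommRing k] {G : Type v} [Group G]

/-- If `M` is cofibrant, so is the cokernel of `M → M ⊗ B`, since this map splits after tensoring
with `B`. -/
theorem projective_TB_cokernel_unit {M : Type (max u v)} [AddCommGroup M] [Module k[G] M]
    [Module.Projective k[G] (TB k G M)] :
    Module.Projective k[G] (TB k G (TB k G M ⧸ LinearMap.range (TB.unit k G M))) := by
  have hex := TB.map_exact (LinearMap.exact_map_mkQ_range (TB.unit k G M))
  have hsurj := TB.map_surjective (Submodule.mkQ_surjective (LinearMap.range (TB.unit k G M)))
  have hret : (TB.mul k G M).comp (TB.map (TB.unit k G M)) = LinearMap.id :=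
    LinearMap.ext TB.mul_map_unit
  have hsplit := (hex.split_tfae (TB.map_injective (TB.unit_injective k G M)) hsurj).out 0 1
  obtain ⟨l, hl⟩ := hsplit.2 ⟨_, hret⟩
  exact Module.Projective.of_split l _ hl

theorem projective_TB_ker {M P : Type (max u v)} [AddCommGroup M] [Module k[G] M]
    [Module.Projective k[G] (TB k G M)] [AddCommGroup P] [Module k[G] P]
    [Module.Projective k[G] P] (f : P →ₗ[k[G]] M) (hf : Function.Surjective f) :
    Module.Projective k[G] (TB k G (LinearMap.ker f)) := by
  have hex := TB.map_exact f.exact_subtype_ker_map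
  have hinj := TB.map_injective (φ := (LinearMap.ker f).subtype) Subtype.val_injective
  obtain ⟨l, hl⟩ := ((hex.split_tfae hinj (TB.map_surjective hf)).out 0 1).1
    (LinearMap.exists_rightInverse_of_surjective _
      (LinearMap.range_eq_top.2 (TB.map_surjective hf)))
  exact Module.Projective.of_split _ l hl

/-- Maps to a projective module extend along a monomorphism with cofibrant cokernel: after
tensoring with `B` the monomorphism splits, and `P` is a retract of `P ⊗ B`. -/
theorem exists_extension_of_cofibrant_cokernel {A E C Q : Type (max u v)}
    [AddCommGroup A] [Module k[G] A] [AddCommGroup E] [Module k[G] E]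
    [AddCommGroup C] [Module k[G] C] [Module.Projective k[G] (TB k G C)]
    [AddCommGroup Q] [Module k[G] Q] [Module.Projective k[G] Q]
    {f : A →ₗ[k[G]] E} {g : E →ₗ[k[G]] C} (hf : Function.Injective f)
    (hg : Function.Surjective g) (hfg : Function.Exact f g) (a : A →ₗ[k[G]] Q) :
    ∃ b : E →ₗ[k[G]] Q, ∀ x, b (f x) = a x := by
  obtain ⟨ρ, hρ⟩ := TB.exists_retraction_unit (k := k) (G := G) Q
  obtain ⟨l, hl⟩ := (((TB.map_exact hfg).split_tfae (TB.map_injective hf)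
    (TB.map_surjective hg)).out 0 1).1 (LinearMap.exists_rightInverse_of_surjective _
      (LinearMap.range_eq_top.2 (TB.map_surjective hg)))
  refine ⟨ρ.comp ((TB.map a).comp (l.comp (TB.unit k G E))), fun x => ?_⟩
  have h1 : l (TB.unit k G E (f x)) = TB.unit k G A x :=
    LinearMap.congr_fun hl (TB.unit k G A x)
  change ρ (TB.map a (l (TB.unit k G E (f x)))) = a x
  rw [h1, TB.map_unit, hρ]

theorem cof_le_gProj : Cof k G ≤ GProj k[G] := by
  intro M hM
  refine gProj_of_syzygies (Cof k G) ?_ ?_ ?_ M hM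
  · intro M hM
    have hM' : Module.Projective k[G] (TB k G M) := hM
    exact ⟨ModuleCat.of k[G] (TB k G M ⧸ LinearMap.range (TB.unit k G M)),
      projective_TB_cokernel_unit, ModuleCat.of k[G] (TB k G M), ModuleCat.ofHom (TB.unit k G M),
      ModuleCat.ofHom (Submodule.mkQ _), hM', TB.unit_injective k G M,
      Submodule.mkQ_surjective _, LinearMap.exact_map_mkQ_range _⟩
  · intro M hM
    have hM' : Module.Projective k[G] (TB k G M) := hM
    let s : (M →₀ k[G]) →ₗ[k[G]] M := Finsupp.linearCombination k[G] id
    have hs : Function.Surjective s := Finsupp.linearCombination_id_surjective k[G] M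
    exact ⟨ModuleCat.of k[G] (LinearMap.ker s), projective_TB_ker s hs,
      ModuleCat.of k[G] (M →₀ k[G]), ModuleCat.ofHom (LinearMap.ker s).subtype,
      ModuleCat.ofHom s, inferInstanceAs (Module.Projective k[G] (M →₀ k[G])),
      Subtype.val_injective, hs, s.exact_subtype_ker_map⟩
  · intro A E C f g hf hg hfg hC Q hQ a
    have hC' : Module.Projective k[G] (TB k G C) := hC
    obtain ⟨b, hb⟩ := exists_extension_of_cofibrant_cokernel (f := f.hom) (g := g.hom)
      hf hg hfg a.hom
    exact ⟨ModuleCat.ofHom b, ModuleCat.hom_ext (LinearMap.ext hb)⟩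

theorem gProj_le_acyclicCokernels {R : Type u} [Ring R] :
    GProj R ≤ AcyclicCokernels.{u, w} R :=
  fun _ ⟨X, hX, hM⟩ => ⟨X, hX.toIsAcyclicProjective, hM⟩

end Cofibrant

/-! ### Approximation of `M ⊗ B` by finitely presented modules -/

section Approximation

/-- A linear map that vanishes on the kernel of a surjection factors through the surjection. -/
theorem exists_comp_eq_of_ker_le {R : Type u} [Ring R] {A B C : Type*} [AddCommGroup A]
    [Module R A] [AddCommGroup B] [Module R B] [AddCommGroup C] [Module R C]
    {g : A →ₗ[R] C} (hg : Function.Surjective g) (h : A →ₗ[R] B)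
    (hgh : ∀ x, g x = 0 → h x = 0) : ∃ h' : C →ₗ[R] B, ∀ x, h' (g x) = h x := by
  refine ⟨((LinearMap.ker g).liftQ h hgh).comp
    (g.quotKerEquivOfSurjective hg).symm.toLinearMap, fun x => ?_⟩
  have : (g.quotKerEquivOfSurjective hg).symm (g x) = (LinearMap.ker g).mkQ x :=
    (LinearEquiv.symm_apply_eq _).2 rfl
  change (LinearMap.ker g).liftQ h hgh ((g.quotKerEquivOfSurjective hg).symm (g x)) = h x
  rw [this]
  rfl

variable {k : Type u} [CommRing k] {G : Type v} [Group G]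
variable {M : Type (max u v)} [AddCommGroup M] [Module k[G] M]
variable {M' : Type (max u v)} [AddCommGroup M'] [Module k[G] M']

theorem TB.range_map_subtype_mono {N N' : Submodule k[G] M} (h : N ≤ N') :
    LinearMap.range (TB.map N.subtype) ≤ LinearMap.range (TB.map N'.subtype) := by
  rintro _ ⟨z, rfl⟩
  exact ⟨TB.map (Submodule.inclusion h) z, by rw [TB.map_map]; rfl⟩

/-- Finitely many elements of the image of `K ⊗ B` in `M ⊗ B` come from `N ⊗ B` for a finitely
generated submodule `N` of `K`. -/
theorem TB.exists_fg_of_finset {K : Submodule k[G] M} (s : Finset (TB k G M))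
    (hs : ∀ z ∈ s, z ∈ LinearMap.range (TB.map (M := K) K.subtype)) :
    ∃ N ≤ K, N.FG ∧ ∀ z ∈ s, z ∈ LinearMap.range (TB.map (M := N) N.subtype) := by
  classical
  have h : ∀ w : TB k G K, ∃ N ≤ K, N.FG ∧
      TB.map (M := K) K.subtype w ∈ LinearMap.range (TB.map (M := N) N.subtype) := by
    intro w
    induction w using TB.induction_on with
    | zero => exact ⟨⊥, bot_le, Submodule.fg_bot, by
        rw [_root_.map_zero]; exact Submodule.zero_mem _⟩
    | tmk m b =>
      exact ⟨Submodule.span k[G] {(m : M)}, (Submodule.span_singleton_le_iff_mem _ _).2 m.2,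
        Submodule.fg_span_singleton _,
        ⟨tmk (⟨m, Submodule.mem_span_singleton_self _⟩ : Submodule.span k[G] {(m : M)}) b, rfl⟩⟩
    | add x y hx hy =>
      obtain ⟨N, hNK, hN, hx⟩ := hx
      obtain ⟨N', hNK', hN', hy⟩ := hy
      refine ⟨N ⊔ N', sup_le hNK hNK', hN.sup hN', ?_⟩
      rw [map_add]
      exact Submodule.add_mem _ (TB.range_map_subtype_mono le_sup_left hx)
        (TB.range_map_subtype_mono le_sup_right hy)
  induction s using Finset.induction_on with
  | empty => exact ⟨⊥, bot_le, Submodule.fg_bot, by simp⟩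
  | insert z s _ ih =>
    obtain ⟨N, hNK, hN, hN₁⟩ := ih fun z hz => hs z (Finset.mem_insert_of_mem hz)
    obtain ⟨w, hw⟩ := hs z (Finset.mem_insert_self z s)
    obtain ⟨N', hNK', hN', hz⟩ := h w
    rw [hw] at hz
    refine ⟨N ⊔ N', sup_le hNK hNK', hN.sup hN', fun x hx => ?_⟩
    rcases Finset.mem_insert.1 hx with rfl | hx
    · exact TB.range_map_subtype_mono le_sup_right hz
    · exact TB.range_map_subtype_mono le_sup_left (hN₁ x hx)

theorem exists_le_supported {R : Type u} [Ring R] {I : Type*} {N : Submodule R (I →₀ R)}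
    (hN : N.FG) : ∃ J : Finset I, N ≤ Finsupp.supported R R (J : Set I) := by
  classical
  obtain ⟨s, rfl⟩ := hN
  refine ⟨s.biUnion Finsupp.support, Submodule.span_le.2 fun x hx => ?_⟩
  exact (Finsupp.mem_supported R x).2
    (Finset.coe_subset.2 (Finset.subset_biUnion_of_mem Finsupp.support hx))

/-- Finitely generated submodules `N` and `K` of a free module lie in a free submodule `F` of finite
rank, whose quotient by `K` is finitely presented. -/
theorem exists_finitePresentation_quotient {R : Type u} [Ring R] {I : Type u}
    {N K : Submodule R (I →₀ R)} (hN : N.FG) (hK : K.FG) :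
    ∃ (F C : ModuleCat.{u} R) (j : F →ₗ[R] (I →₀ R)) (q : F →ₗ[R] C),
      Function.Injective j ∧ N ≤ LinearMap.range j ∧ K ≤ LinearMap.range j ∧
      Function.Surjective q ∧ (∀ x, q x = 0 ↔ j x ∈ K) ∧ Module.FinitePresentation R C := by
  obtain ⟨J, hJ⟩ := exists_le_supported (hN.sup hK)
  let j : (J →₀ R) →ₗ[R] (I →₀ R) := Finsupp.lmapDomain R R Subtype.val
  have hj : Function.Injective j := Finsupp.mapDomain_injective Subtype.val_injective
  have hJj : Finsupp.supported R R (J : Set I) ≤ LinearMap.range j := fun x hx =>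
    ⟨Finsupp.comapDomain Subtype.val x Subtype.val_injective.injOn,
      Finsupp.mapDomain_comapDomain _ Subtype.val_injective x fun i hi =>
        ⟨⟨i, (Finsupp.mem_supported R x).1 hx hi⟩, rfl⟩⟩
  have hK' : (K.comap j).FG := by
    refine Submodule.fg_of_fg_map_injective j hj ?_
    rwa [Submodule.map_comap_eq, inf_eq_right.2 ((le_sup_right.trans hJ).trans hJj)]
  exact ⟨ModuleCat.of R (J →₀ R), ModuleCat.of R ((J →₀ R) ⧸ K.comap j), j,
    (K.comap j).mkQ, hj, (le_sup_left.trans hJ).trans hJj, (le_sup_right.trans hJ).trans hJj,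
    Submodule.mkQ_surjective _, fun x => Submodule.Quotient.mk_eq_zero _,
    Module.finitePresentation_of_surjective _ (Submodule.mkQ_surjective _)
      (by rwa [Submodule.ker_mkQ])⟩

theorem TB.map_zero : TB.map (0 : M →ₗ[k[G]] M') = 0 :=
  TB.hom_ext fun m b => by
    rw [TB.map_tmk, LinearMap.zero_apply, _root_.map_zero]
    rfl

theorem mem_of_forall_single_mem {R : Type*} [Ring R] {a : ℕ} {p : Submodule R (Fin a → R)}
    (h : ∀ i, Pi.single i 1 ∈ p) (x : Fin a → R) : x ∈ p := by
  refine Submodule.span_le.2 ?_ ((Pi.basisFun R (Fin a)).mem_span x)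
  rintro _ ⟨i, rfl⟩
  rw [Pi.basisFun_apply]
  exact h i

variable (M) in
/-- Any map from a finitely presented module to `M ⊗ B` factors through `C ⊗ B` for some finitely
presented module `C` over `M`. -/
theorem exists_factorization_TB {D : Type (max u v)} [AddCommGroup D] [Module k[G] D]
    [Module.FinitePresentation k[G] D] (φ : D →ₗ[k[G]] TB k G M) :
    ∃ (C : ModuleCat.{max u v} k[G]) (c : C →ₗ[k[G]] M) (g : D →ₗ[k[G]] TB k G C),
      Module.FinitePresentation k[G] C ∧ (TB.map c).comp g = φ := by
  classical
  obtain ⟨a, b, f₀, g₀, hf₀, hgf⟩ := Module.FinitePresentation.exists_fin' k[G] D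
  -- a presentation `K → F → M` of `M`, and a lift of the generators of `D` to `F ⊗ B`
  let p : (M →₀ k[G]) →ₗ[k[G]] M := Finsupp.linearCombination k[G] id
  have hp : Function.Surjective p := Finsupp.linearCombination_id_surjective k[G] M
  obtain ⟨θ, hθ⟩ := Module.projective_lifting_property (TB.map p) (φ.comp f₀)
    (TB.map_surjective hp)
  have hθ' : ∀ x, TB.map p (θ x) = φ (f₀ x) := fun x => LinearMap.congr_fun hθ x
  obtain ⟨N, -, hN, hNθ⟩ := TB.exists_fg_of_finset (K := ⊤)
    (Finset.univ.image fun i : Fin a => θ (Pi.single i 1)) fun z _ =>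
      TB.map_surjective (fun x => ⟨⟨x, Submodule.mem_top⟩, rfl⟩) z
  -- the relations of `D` come from finitely many relations of `M`
  obtain ⟨K', hK'p, hK'fg, hK'⟩ := TB.exists_fg_of_finset (K := LinearMap.ker p)
    (Finset.univ.image fun j : Fin b => θ (g₀ (Pi.single j 1))) fun z hz => by
      obtain ⟨j, -, rfl⟩ := Finset.mem_image.1 hz
      refine (TB.map_exact p.exact_subtype_ker_map _).1 ?_
      rw [hθ', (hgf _).2 ⟨_, rfl⟩, _root_.map_zero]
  obtain ⟨F, C, j, q, hj, hNj, hKj, hq, hqK, hC⟩ := exists_finitePresentation_quotient hN hK'fg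
  have hinj := TB.map_injective (k := k) (G := G) hj
  have hmono : ∀ {N : Submodule k[G] (M →₀ k[G])}, N ≤ LinearMap.range j →
      ∃ i : N →ₗ[k[G]] F, j.comp i = N.subtype := by
    intro N hN
    refine ⟨(LinearEquiv.ofInjective j hj).symm.toLinearMap.comp (Submodule.inclusion hN),
      LinearMap.ext fun x => ?_⟩
    exact LinearEquiv.ofInjective_symm_apply (h := hj) _ _
  obtain ⟨iN, hiN⟩ := hmono hNj
  obtain ⟨iK, hiK⟩ := hmono hKj
  have hθj : ∀ x, θ x ∈ LinearMap.range (TB.map j) :=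
    mem_of_forall_single_mem (p := (LinearMap.range (TB.map j)).comap θ) fun i => by
      obtain ⟨u, hu⟩ := hNθ _ (Finset.mem_image_of_mem _ (Finset.mem_univ i))
      exact ⟨TB.map iN u, by rw [TB.map_map, hiN]; exact hu⟩
  let θ' : (Fin a → k[G]) →ₗ[k[G]] TB k G F :=
    (LinearEquiv.ofInjective _ hinj).symm.toLinearMap.comp (θ.codRestrict _ hθj)
  have hθ'' : ∀ x, TB.map j (θ' x) = θ x := fun x =>
    LinearEquiv.ofInjective_symm_apply (h := hinj) _ _
  have hzero : ∀ y, TB.map q (θ' (g₀ y)) = 0 :=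
    mem_of_forall_single_mem
      (p := LinearMap.ker ((TB.map q).comp (θ'.comp g₀))) fun i => by
        obtain ⟨u, hu⟩ := hK' _ (Finset.mem_image_of_mem _ (Finset.mem_univ i))
        have h1 : θ' (g₀ (Pi.single i 1)) = TB.map iK u := by
          refine hinj ?_
          rw [hθ'', ← hu, TB.map_map, hiK]
        have h2 : q.comp iK = 0 := LinearMap.ext fun x => (hqK _).2 <| by
          rw [← LinearMap.comp_apply, hiK]
          exact x.2
        change TB.map q (θ' (g₀ (Pi.single i 1))) = 0
        rw [h1, TB.map_map, h2, TB.map_zero, LinearMap.zero_apply]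
  obtain ⟨g, hg⟩ := exists_comp_eq_of_ker_le hf₀ ((TB.map q).comp θ') fun x hx => by
    obtain ⟨y, rfl⟩ := (hgf x).1 hx
    exact hzero y
  obtain ⟨c, hc⟩ := exists_comp_eq_of_ker_le hq (p.comp j) fun x hx => hK'p ((hqK x).1 hx)
  have hc' : c.comp q = p.comp j := LinearMap.ext hc
  refine ⟨C, c, g, hC, LinearMap.ext fun x => ?_⟩
  obtain ⟨x, rfl⟩ := hf₀ x
  change TB.map c (g (f₀ x)) = φ (f₀ x)
  rw [hg, ← hθ', ← hθ'']
  change TB.map c (TB.map q (θ' x)) = _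
  rw [TB.map_map, TB.map_map, hc']

variable (M) in
theorem factorsThroughDimLE_TB {n : ℕ}
    (H : ∀ C : ModuleCat.{max u v} k[G], Module.FinitePresentation k[G] C →
      HasProjectiveDimensionLE (tensorB C) n) : FactorsThroughDimLE k[G] (TB k G M) n := by
  intro D _ _ _ φ
  obtain ⟨C, c, g, hC, hcg⟩ := exists_factorization_TB M φ
  exact ⟨tensorB C, H C hC, g, TB.map c, hcg⟩

end Approximation

/-! ### Cokernels of acyclic complexes are cofibrant -/

section Periodic

variable {k : Type u} [CommRing k] {G : Type v} [Group G]

/-- If `d` is an exact differential on a projective module, then its image is cofibrant. -/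
theorem projective_TB_range {n : ℕ}
    (H : ∀ C : ModuleCat.{max u v} k[G], Module.FinitePresentation k[G] C →
      HasProjectiveDimensionLE (tensorB C) n) {P : Type (max u v)} [AddCommGroup P]
    [Module k[G] P] [Module.Projective k[G] P] {d : P →ₗ[k[G]] P} (hd : Function.Exact d d) :
    Module.Projective k[G] (TB k G (LinearMap.range d)) := by
  let φ := TB.map (k := k) (G := G) (LinearMap.range d).subtype
  have hφ : Function.Injective φ := TB.map_injective Subtype.val_injective
  have hr : LinearMap.range φ = LinearMap.range (TB.map (k := k) (G := G) d) := by
    have h1 : TB.map (k := k) (G := G) d = φ.comp (TB.map d.rangeRestrict) := by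
      rw [← TB.map_comp]; rfl
    rw [h1, LinearMap.range_comp_of_range_eq_top]
    exact LinearMap.range_eq_top.2 (TB.map_surjective d.surjective_rangeRestrict)
  let e : TB k G (LinearMap.range d) ≃ₗ[k[G]] LinearMap.range (TB.map (k := k) (G := G) d) :=
    (LinearEquiv.ofInjective φ hφ).trans (LinearEquiv.ofEq _ _ hr)
  have HF : FactorsThroughDimLE k[G] (LinearMap.range (TB.map (k := k) (G := G) d)) n := by
    intro D _ _ _ f
    obtain ⟨L, hL, g, h, hgh⟩ :=
      factorsThroughDimLE_TB (LinearMap.range d) H D (e.symm.toLinearMap.comp f)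
    refine ⟨L, hL, g, e.toLinearMap.comp h, LinearMap.ext fun x => ?_⟩
    have := LinearMap.congr_fun hgh x
    change e (h (g x)) = f x
    rw [← LinearMap.comp_apply, hgh]
    exact e.apply_symm_apply _
  have := projective_range_of_factorsThroughDimLE (TB.map_exact hd) HF
  exact Module.Projective.of_equiv' e.symm

/-- The cokernels of an exact complex of projective modules are direct summands of the image of an
exact differential on a projective module, namely on the sum of the terms of the complex. -/
theorem AcyclicCokernels.exists_retract_range {R : Type u} [Ring R] {M : ModuleCat.{u} R}
    (hM : AcyclicCokernels R M) :
    ∃ (P : Type u) (_ : AddCommGroup P) (_ : Module R P) (d : P →ₗ[R] P),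
      Module.Projective R P ∧ Function.Exact d d ∧
      ∃ (s : M →ₗ[R] LinearMap.range d) (r : LinearMap.range d →ₗ[R] M), ∀ x, r (s x) = x := by
  classical
  obtain ⟨X, ⟨hP, hX⟩, i, ⟨e⟩⟩ := hM
  rw [acyclic_iff_exact] at hX
  let d : (⨁ i, X.X i) →ₗ[R] (⨁ i, X.X i) := DirectSum.toModule R ℤ _ fun i =>
    (DirectSum.lof R ℤ (fun i => X.X i) (i + 1)).comp (X.d i (i + 1)).hom
  have hd : ∀ i x, d (DirectSum.lof R ℤ (fun i => X.X i) i x) =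
      DirectSum.lof R ℤ (fun i => X.X i) (i + 1) (X.d i (i + 1) x) := fun i x => by simp [d]
  have hd' : ∀ x i, d x (i + 1) = X.d i (i + 1) (x i) := by
    intro x i
    induction x using DirectSum.induction_on with
    | zero => simp
    | add x y hx hy => rw [map_add, DirectSum.add_apply, hx, hy, DirectSum.add_apply, map_add]
    | of j x =>
      rw [← DirectSum.lof_eq_of R, hd, DirectSum.lof_eq_of, DirectSum.lof_eq_of]
      by_cases h : j = i
      · subst h
        rw [DirectSum.of_eq_same, DirectSum.of_eq_same]
      · rw [DirectSum.of_eq_of_ne _ _ _ (by simpa using Ne.symm h),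
          DirectSum.of_eq_of_ne _ _ _ (Ne.symm h), map_zero]
  have hdd : Function.Exact d d := by
    intro x
    constructor
    · intro hx
      change x ∈ LinearMap.range d
      rw [← DirectSum.sum_support_of x]
      refine Submodule.sum_mem _ fun j _ => ?_
      obtain ⟨i, rfl⟩ : ∃ i, j = i + 1 := ⟨j - 1, by ring⟩
      obtain ⟨y, hy⟩ := (hX i (x (i + 1))).1 (by rw [← hd', hx]; rfl)
      exact ⟨DirectSum.lof R ℤ (fun i => X.X i) i y, by rw [hd, hy]; rfl⟩
    · rintro ⟨y, rfl⟩
      refine DirectSum.ext_component R fun j => ?_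
      change d (d y) j = 0
      obtain ⟨i, rfl⟩ : ∃ i, j = i + 1 := ⟨j - 1, by ring⟩
      obtain ⟨i, rfl⟩ : ∃ j, i = j + 1 := ⟨i - 1, by ring⟩
      rw [hd', hd']
      exact (hX i _).2 ⟨_, rfl⟩
  let π : X.X (i + 1) ⟶ M := Limits.cokernel.π (X.d i (i + 1)) ≫ e.inv
  have hπ : Function.Surjective π := (ModuleCat.epi_iff_surjective π).1 inferInstance
  have hdπ : Function.Exact (X.d i (i + 1)) π := by
    have h0 := (ShortComplex.ShortExact.moduleCat_exact_iff_function_exact _).1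
      (ShortComplex.exact_cokernel (X.d i (i + 1)))
    intro x
    refine Iff.trans ?_ (h0 x)
    exact map_eq_zero_iff e.inv.hom ((ModuleCat.mono_iff_injective e.inv).1 inferInstance)
  obtain ⟨s, hs⟩ := exists_comp_eq_of_ker_le (g := π.hom) hπ
    (d.rangeRestrict.comp (DirectSum.lof R ℤ (fun i => X.X i) (i + 1))) fun x hx => by
      obtain ⟨y, rfl⟩ := (hdπ x).1 hx
      refine Subtype.ext ?_
      change d (DirectSum.lof R ℤ (fun i => X.X i) (i + 1) (X.d i (i + 1) y)) = 0
      rw [← hd]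
      exact (hdd _).2 ⟨_, rfl⟩
  obtain ⟨r, hr⟩ := exists_comp_eq_of_ker_le d.surjective_rangeRestrict
    (π.hom.comp (DirectSum.component R ℤ (fun i => X.X i) (i + 1))) fun x hx => by
      obtain ⟨y, rfl⟩ := (hdd x).1 (congrArg Subtype.val hx)
      change π (d y (i + 1)) = 0
      rw [hd']
      exact (hdπ _).2 ⟨_, rfl⟩
  refine ⟨⨁ i, X.X i, inferInstance, inferInstance, d, inferInstance, hdd, s, r, fun x => ?_⟩
  obtain ⟨x, rfl⟩ := hπ x
  have h1 : s (π x) = _ := hs x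
  rw [h1]
  refine (hr _).trans ?_
  change π (DirectSum.component R ℤ (fun i => X.X i) (i + 1) (DirectSum.lof R ℤ _ (i + 1) x)) = π x
  rw [DirectSum.component.lof_self]

theorem acyclicCokernels_le_cof {n : ℕ}
    (H : ∀ C : ModuleCat.{max u v} k[G], Module.FinitePresentation k[G] C →
      HasProjectiveDimensionLE (tensorB C) n) : AcyclicCokernels k[G] ≤ Cof k G := by
  intro M hM
  obtain ⟨P, _, _, d, hP, hd, s, r, hrs⟩ := hM.exists_retract_range
  have := projective_TB_range H hd
  refine Module.Projective.of_split (TB.map s) (TB.map r) (LinearMap.ext fun x => ?_)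
  change TB.map r (TB.map s x) = x
  rw [TB.map_map, show r.comp s = LinearMap.id from LinearMap.ext hrs, TB.map_id]
  rfl

end Periodic

/-! ### Pure-projective modules of finite cofibrant dimension -/

section Dimension

variable {k : Type u} [CommRing k] {G : Type v} [Group G]

theorem hasProjectiveDimensionLE_tensorB_of_retract {M N : ModuleCat.{max u v} k[G]}
    (h : Retract M N) {n : ℕ} (hN : HasProjectiveDimensionLE (tensorB N) n) :
    HasProjectiveDimensionLE (tensorB M) n := by
  let h' : Retract (tensorB M) (tensorB N) :=
    { i := ModuleCat.ofHom (TB.map h.i.hom)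
      r := ModuleCat.ofHom (TB.map h.r.hom)
      retract := ModuleCat.hom_ext (LinearMap.ext fun x => by
        change TB.map h.r.hom (TB.map h.i.hom x) = x
        have : h.r.hom.comp h.i.hom = LinearMap.id := by
          rw [← ModuleCat.hom_comp, h.retract]; rfl
        rw [TB.map_map, this, TB.map_id]
        rfl) }
  exact h'.hasProjectiveDimensionLT (n + 1)

theorem hasProjectiveDimensionLE_tensorB_directSum {ι : Type (max u v)}
    (C : ι → ModuleCat.{max u v} k[G]) {n : ℕ}
    (hC : ∀ i, HasProjectiveDimensionLE (tensorB (C i)) n) :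
    HasProjectiveDimensionLE (tensorB (ModuleCat.of k[G] (⨁ i, C i))) n := by
  obtain ⟨s, r, hrs, -⟩ := TB.exists_retract_directSum (k := k) (G := G) fun i => C i
  let h : Retract (tensorB (ModuleCat.of k[G] (⨁ i, C i)))
      (ModuleCat.of k[G] (⨁ i, tensorB (C i))) :=
    { i := ModuleCat.ofHom s
      r := ModuleCat.ofHom r
      retract := ModuleCat.hom_ext (LinearMap.ext hrs) }
  have := hasProjectiveDimensionLE_directSum (fun i => tensorB (C i)) n hC
  exact h.hasProjectiveDimensionLT (n + 1)

theorem pProj_le_finCof_iff : PProj k[G] ≤ FinCof k G ↔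
    ∃ n : ℕ, ∀ C : ModuleCat.{max u v} k[G], Module.FinitePresentation k[G] C →
      HasProjectiveDimensionLE (tensorB C) n := by
  classical
  constructor
  · intro H
    by_contra! hC
    -- if `C n` has cofibrant dimension more than `n`, then the sum of the `C n` has infinite one
    choose C hC hC' using hC
    let C' : ULift.{max u v} ℕ → ModuleCat.{max u v} k[G] := fun n => C n.down
    obtain ⟨n, hn⟩ := H (ModuleCat.of k[G] (⨁ i, C' i)) ⟨_, C', fun i => hC _, ⟨Retract.refl _⟩⟩
    refine hC' n (hasProjectiveDimensionLE_tensorB_of_retract (N := ModuleCat.of k[G] (⨁ i, C' i))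
      { i := ModuleCat.ofHom (DirectSum.lof k[G] _ (fun i => C' i) (ULift.up n))
        r := ModuleCat.ofHom (DirectSum.component k[G] _ (fun i => C' i) (ULift.up n))
        retract := ModuleCat.hom_ext (LinearMap.ext fun x => ?_) } hn)
    exact DirectSum.component.lof_self (M := fun i => C' i) k[G] (ULift.up n) x
  · rintro ⟨n, hn⟩ M ⟨ι, C, hC, ⟨h⟩⟩
    exact ⟨n, hasProjectiveDimensionLE_tensorB_of_retract h
      (hasProjectiveDimensionLE_tensorB_directSum C fun i => hn _ (hC i))⟩

end Dimension

end GroupAlgebraModules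

end

theorem theorem2p7 (k : Type u) [CommRing k] (G : Type v) [Group G] :
    (GroupAlgebraModules.PProj k[G] ≤ GroupAlgebraModules.FinCof k G ↔
      ∃ n : ℕ, ∀ C : ModuleCat.{max u v} k[G], Module.FinitePresentation k[G] C →
        HasProjectiveDimensionLE (GroupAlgebraModules.tensorB C) n) ∧
    (GroupAlgebraModules.PProj k[G] ≤ GroupAlgebraModules.FinCof k G →
      GroupAlgebraModules.Cof k G = GroupAlgebraModules.GProj k[G] ∧
      GroupAlgebraModules.GProj k[G] =
        GroupAlgebraModules.AcyclicCokernels.{max u v, max u v} k[G]) := by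
  refine ⟨GroupAlgebraModules.pProj_le_finCof_iff, fun h => ?_⟩
  obtain ⟨n, hn⟩ := GroupAlgebraModules.pProj_le_finCof_iff.1 h
  have h₁ := GroupAlgebraModules.cof_le_gProj (k := k) (G := G)
  have h₂ := GroupAlgebraModules.gProj_le_acyclicCokernels (R := k[G])
  have h₃ := GroupAlgebraModules.acyclicCokernels_le_cof hn
  exact ⟨le_antisymm h₁ (h₂.trans h₃), le_antisymm h₂ (h₃.trans h₁)⟩
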